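/- Let $a>0$ and $g,\gamma\in L^2(\mathbb{R})$. For $x,\omega\in\mathbb{R}$ write $\pi(x,\omega)f(t)=e^{2\pi i\omega(t-x)}f(t-x)$, and for $f\in L^2(\mathbb{R})$ let $G(f,a,1/a)=\{\pi(an,m/a)f\}_{n,m\in\mathbb{Z}}$ be the Gabor system at critical density generated by $f$. Two families $\{\psi_k\}_{k\in I}$, $\{\phi_k\}_{k\in I}$ in a Hilbert space $H$ form a reproducing pair if there is a bounded, boundedly invertible linear operator $S:H\to H$ such that $$\langle Sf,h\rangle=\sum_{k\in I}\langle f,\psi_k\rangle\langle\phi_k,h\rangle\qquad\text{for all } f,h\in H .$$ Here the sums over the countable set $I$ may be taken unconditionally or as limits of finite partial sums in any other fixed sense under which every finite subset of $I$ is eventually included (for example along an enumeration of $I$, or over growing rectangles when $I=\mathbb{Z}^2$). Let $M^1_1$ be the weighted modulation space of all $f\in L^2(\mathbb{R})$ such that $$\int_{\mathbb{R}^2}|\langle f,\pi(x,\omega)\varphi\rangle|\,(1+|x|+|\omega|)\,dx\,d\omega<\infty,$$ where $\varphi$ is a nonzero Schwartz function, which may be chosen arbitrarily. If $\big(G(g,a,1/a),G(\gamma,a,1/a)\big)$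 is a reproducing pair, then both $g\notin M^1_1$ and $\gamma\notin M^1_1$. -/

import Mathlib

open MeasureTheory
open scoped SchwartzMap ENNReal

noncomputable section

/-- `L²(ℝ)`, complex valued, with respect to Lebesgue measure. -/
abbrev L2R : Type := Lp ℂ 2 (volume : Measure ℝ)

/-- The time-frequency shift `π(x, ω) g (t) = e^{2π i ω (t - x)} g (t - x)` of a function. -/
def tfShiftFun (z : ℝ × ℝ) (g : ℝ → ℂ) : ℝ → ℂ := fun t =>
  Complex.exp (2 * Real.pi * Complex.I * z.2 * (t - z.1)) * g (t - z.1)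

theorem memLp_tfShiftFun (z : ℝ × ℝ) {g : ℝ → ℂ} (hg : MemLp g 2 (volume : Measure ℝ)) :
    MemLp (tfShiftFun z g) 2 (volume : Measure ℝ) := by
  have h1 : MemLp (fun t : ℝ => g (t - z.1)) 2 (volume : Measure ℝ) :=
    hg.comp_measurePreserving (measurePreserving_sub_right volume z.1)
  have hc : Continuous (fun t : ℝ =>
      Complex.exp (2 * Real.pi * Complex.I * z.2 * (t - z.1))) := by fun_prop
  refine h1.of_le (hc.aestronglyMeasurable.mul h1.aestronglyMeasurable) (ae_of_all _ fun t => ?_)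
  have h2 : ‖Complex.exp (2 * Real.pi * Complex.I * z.2 * (t - z.1))‖ = 1 := by
    have h3 : (2 * Real.pi * Complex.I * z.2 * (t - z.1) : ℂ)
        = ((2 * Real.pi * z.2 * (t - z.1) : ℝ) : ℂ) * Complex.I := by
      push_cast; ring
    rw [h3, Complex.norm_exp_ofReal_mul_I]
  simp only [tfShiftFun, norm_mul, h2, one_mul, le_refl]

/-- The time-frequency shift `π(x, ω)` on `L²(ℝ)`. -/
def tfShift (z : ℝ × ℝ) (g : L2R) : L2R :=
  (memLp_tfShiftFun z (Lp.memLp g)).toLp (tfShiftFun z g)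

/-- The short-time Fourier transform `V_g f (z) = ⟨f, π(z) g⟩`, where `⟨·, ·⟩` is linear in its
first argument (Mathlib's `inner` is linear in the second one). -/
def stft (g f : L2R) (z : ℝ × ℝ) : ℂ := inner ℂ (tfShift z g) f

/-- The Gabor system `G(g, a, b) = (π(a n, b m) g)_{n, m ∈ ℤ}`, as an indexed family. -/
def gaborSystem (g : L2R) (a b : ℝ) : ℤ × ℤ → L2R := fun k => tfShift (a * k.1, b * k.2) g

/-- The weight `v_s(x, ω) = (1 + |x| + |ω|)^s`. -/
def vWeight (s : ℝ) (z : ℝ × ℝ) : ℝ := (1 + |z.1| + |z.2|) ^ s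

/-- The modulation space `M^p_s`, defined through the (nonzero) Schwartz window `φ`. -/
def modulationSpace (φ : 𝓢(ℝ, ℂ)) (p : ℝ≥0∞) (s : ℝ) : Set L2R :=
  {f | MemLp (fun z : ℝ × ℝ => stft (φ.toLp 2) f z * (vWeight s z : ℂ)) p volume}

/-- `(Ψ, Φ)` is a reproducing pair: there is a bounded, boundedly invertible operator `S` with
`⟨S f, h⟩ = ∑ₖ ⟨f, ψₖ⟩ ⟨φₖ, h⟩` for all `f, h`. The summation filter `L` says how the
finite partial sums are taken: unconditionally by default, otherwise for instance in the order of
an enumeration of the index set or over growing rectangles. -/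
def IsReproducingPair {ι H : Type*} [NormedAddCommGroup H] [InnerProductSpace ℂ H]
    (Ψ Φ : ι → H) (L : SummationFilter ι := SummationFilter.unconditional ι) : Prop :=
  ∃ S : H ≃L[ℂ] H, ∀ f h : H,
    HasSum (fun k => inner ℂ (Ψ k) f * inner ℂ h (Φ k)) (inner ℂ h (S f)) L

end

noncomputable section

open Set Filter Topology ComplexConjugate FourierTransform

/-! The proof goes through the Zak transform `Zf(ξ, x) = √a ∑ₙ e^{2πinξ} f(a(x + n))`, a unitary map
from `L²(ℝ)` onto `L²` of the unit square. At critical density it turns each `π(an, m/a)` into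
multiplication by `e^{2πi(nξ + mx)}` (`zak_gaborSystem`). By Parseval, the operator of the
reproducing pair is then multiplication by `conj (Zg) * Zγ`, and its bounded invertibility forces
`|Zg| |Zγ| ≥ c > 0` almost everywhere (`exists_le_norm_zak_mul_norm_zak`).

Suppose `g ∈ M¹₁`. The inversion formula (`ae_eq_stftSynthesis`) writes `g` as a superposition of
time-frequency shifts of a Schwartz function. The weight `1 + |x| + |ω|` pays for one derivative and
for one factor `|n|`, so the Zak series of `g` is Lipschitz (`exists_lipschitz_zak`). A continuous
Zak transform is quasi-periodic, and a winding argument gives it a zero `p₀`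
(`exists_eq_zero_of_quasiperiodic`). Near `p₀` one has `|Zγ| ≥ c / |Zg| ≥ c' / dist(p, p₀)`, which
is not square integrable in dimension two (`not_ae_le_norm_mul_norm_of_lipschitz`), while `Zγ ∈ L²`.
The roles of `g` and `γ` are symmetric. -/

/-! ### Fourier analysis on the unit interval and the unit square. -/

/-- Lebesgue measure on the unit interval `(0, 1]`. -/
abbrev unitMeasure : Measure ℝ := volume.restrict (Ioc 0 1)

/-- Lebesgue measure on the unit square `(0, 1] × (0, 1]`. -/
abbrev squareMeasure : Measure (ℝ × ℝ) := unitMeasure.prod unitMeasure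

instance isProbabilityMeasure_unitMeasure : IsProbabilityMeasure unitMeasure := ⟨by simp⟩

/-- The exponential `x ↦ e^{2π i m x}`. -/
def unitExp (m : ℤ) (x : ℝ) : ℂ := Complex.exp (2 * Real.pi * Complex.I * m * x)

/-- The exponential `(ξ, x) ↦ e^{2π i (n ξ + m x)}` for `k = (n, m)`. -/
def squareExp (k : ℤ × ℤ) (p : ℝ × ℝ) : ℂ := unitExp k.1 p.1 * unitExp k.2 p.2

@[fun_prop]
theorem continuous_unitExp (m : ℤ) : Continuous (unitExp m) := by
  unfold unitExp; fun_prop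

@[fun_prop]
theorem continuous_squareExp (k : ℤ × ℤ) : Continuous (squareExp k) := by
  unfold squareExp; fun_prop

theorem unitExp_eq_exp_ofReal_mul_I (m : ℤ) (x : ℝ) :
    unitExp m x = Complex.exp (((2 * Real.pi * m * x : ℝ) : ℂ) * Complex.I) := by
  rw [unitExp]; congr 1; push_cast; ring

@[simp]
theorem norm_unitExp (m : ℤ) (x : ℝ) : ‖unitExp m x‖ = 1 := by
  rw [unitExp_eq_exp_ofReal_mul_I, Complex.norm_exp_ofReal_mul_I]

@[simp]
theorem norm_squareExp (k : ℤ × ℤ) (p : ℝ × ℝ) : ‖squareExp k p‖ = 1 := by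
  simp [squareExp]

theorem unitExp_add (m n : ℤ) (x : ℝ) : unitExp (m + n) x = unitExp m x * unitExp n x := by
  simp only [unitExp, ← Complex.exp_add]; congr 1; push_cast; ring

@[simp]
theorem unitExp_zero (x : ℝ) : unitExp 0 x = 1 := by simp [unitExp]

theorem conj_unitExp (m : ℤ) (x : ℝ) : conj (unitExp m x) = unitExp (-m) x := by
  rw [unitExp, unitExp, ← Complex.exp_conj]
  congr 1
  simp [map_ofNat]

theorem unitExp_add_intCast (m : ℤ) (x : ℝ) (n : ℤ) : unitExp m (x + n) = unitExp m x := by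
  rw [unitExp, unitExp, Complex.exp_eq_exp_iff_exists_int]
  exact ⟨m * n, by push_cast; ring⟩

theorem unitExp_one_right (m : ℤ) : unitExp m 1 = 1 := by
  have := unitExp_add_intCast m 0 1
  simpa [unitExp] using this

theorem squareExp_add (k l : ℤ × ℤ) (p : ℝ × ℝ) :
    squareExp (k + l) p = squareExp k p * squareExp l p := by
  simp only [squareExp, Prod.fst_add, Prod.snd_add, unitExp_add]; ring

theorem conj_squareExp (k : ℤ × ℤ) (p : ℝ × ℝ) :
    conj (squareExp k p) = squareExp (-k) p := by
  simp [squareExp, conj_unitExp]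

theorem integral_unitExp (m : ℤ) : ∫ x, unitExp m x ∂unitMeasure = if m = 0 then 1 else 0 := by
  split_ifs with h
  · simp [h]
  · rw [← intervalIntegral.integral_of_le zero_le_one]
    have hc : (2 * Real.pi * Complex.I * m : ℂ) ≠ 0 := by
      simp [Real.pi_ne_zero, h]
    simp only [unitExp]
    rw [integral_exp_mul_complex hc]
    have := unitExp_one_right m
    rw [unitExp] at this
    rw [this]
    simp

theorem integral_squareExp (k : ℤ × ℤ) :
    ∫ p, squareExp k p ∂squareMeasure = if k = 0 then 1 else 0 := by
  simp only [squareExp]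
  rw [integral_prod_mul, integral_unitExp, integral_unitExp]
  rcases k with ⟨n, m⟩
  simp only [Prod.mk_eq_zero]
  split_ifs <;> simp_all

/-- An `L²` function on the unit interval whose Fourier coefficients vanish is zero. -/
theorem ae_eq_zero_of_integral_unitExp_mul {f : ℝ → ℂ} (hf : MemLp f 2 unitMeasure)
    (h : ∀ m : ℤ, ∫ x, unitExp m x * f x ∂unitMeasure = 0) : f =ᵐ[unitMeasure] 0 := by
  have hs := hasSum_sq_fourierCoeffOn (a := 0) (b := 1) zero_lt_one hf
  have hz : ∀ m, fourierCoeffOn (zero_lt_one (α := ℝ)) f m = 0 := by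
    intro m
    rw [fourierCoeffOn_eq_integral, intervalIntegral.integral_of_le zero_le_one]
    convert! smul_zero _
    rw [← h (-m)]
    refine integral_congr_ae (ae_of_all _ fun x => ?_)
    simp only [smul_eq_mul]
    congr 1
    rw [fourier_coe_apply, unitExp]
    simp
  simp only [hz, norm_zero, ne_eq, OfNat.ofNat_ne_zero, not_false_eq_true, zero_pow] at hs
  have h0 := hs.unique hasSum_zero
  rw [intervalIntegral.integral_of_le zero_le_one] at h0
  have h1 : ∫ x in Ioc (0 : ℝ) 1, ‖f x‖ ^ 2 = 0 := by simpa using h0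
  rw [integral_eq_zero_iff_of_nonneg (fun x => by positivity)
    ((memLp_two_iff_integrable_sq_norm hf.1).1 hf)] at h1
  filter_upwards [h1] with x hx
  simpa using hx

/-- An `L²` function on the unit square whose Fourier coefficients vanish is zero. -/
theorem ae_eq_zero_of_integral_squareExp_mul {f : ℝ × ℝ → ℂ} (hf : MemLp f 2 squareMeasure)
    (h : ∀ k : ℤ × ℤ, ∫ p, squareExp k p * f p ∂squareMeasure = 0) : f =ᵐ[squareMeasure] 0 := by
  have hsq : Integrable (fun p => ‖f p‖ ^ 2) squareMeasure :=
    (memLp_two_iff_integrable_sq_norm hf.1).1 hf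
  have hfi : Integrable f squareMeasure := hf.integrable (by norm_num)
  have hslice : ∀ᵐ ξ ∂unitMeasure, MemLp (fun x => f (ξ, x)) 2 unitMeasure := by
    filter_upwards [hsq.prod_right_ae, hf.1.prodMk_left] with ξ h1 h2
    exact (memLp_two_iff_integrable_sq_norm h2).2 h1
  have hmem : ∀ m : ℤ, MemLp (fun ξ => ∫ x, unitExp m x * f (ξ, x) ∂unitMeasure) 2
      unitMeasure := by
    intro m
    have hmeas : AEStronglyMeasurable (fun p : ℝ × ℝ => unitExp m p.2 * f p) squareMeasure :=
      (by fun_prop : Continuous fun p : ℝ × ℝ => unitExp m p.2).aestronglyMeasurable.mul hf.1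
    rw [memLp_two_iff_integrable_sq_norm hmeas.integral_prod_right']
    refine hsq.integral_prod_left.mono' (hmeas.integral_prod_right'.norm.pow 2) ?_
    filter_upwards [hslice] with ξ hξ
    rw [Real.norm_of_nonneg (by positivity)]
    have h1 : ‖∫ x, unitExp m x * f (ξ, x) ∂unitMeasure‖ ≤ ∫ x, ‖f (ξ, x)‖ ∂unitMeasure := by
      refine (norm_integral_le_integral_norm _).trans_eq ?_
      simp
    -- Jensen's inequality on a probability space.
    have h2 : (∫ x, ‖f (ξ, x)‖ ∂unitMeasure) ^ 2 ≤ ∫ x, ‖f (ξ, x)‖ ^ 2 ∂unitMeasure :=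
      ConvexOn.map_integral_le (convexOn_pow 2) (by fun_prop) isClosed_Ici
        (ae_of_all _ fun x => norm_nonneg _) (hξ.integrable (by norm_num)).norm
        ((memLp_two_iff_integrable_sq_norm hξ.1).1 hξ)
    exact (pow_le_pow_left₀ (norm_nonneg _) h1 2).trans h2
  have hcoef : ∀ m : ℤ, ∀ᵐ ξ ∂unitMeasure, ∫ x, unitExp m x * f (ξ, x) ∂unitMeasure = 0 := by
    intro m
    refine ae_eq_zero_of_integral_unitExp_mul (hmem m) fun n => ?_
    rw [← h (n, m), integral_prod]
    · refine integral_congr_ae (ae_of_all _ fun ξ => ?_)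
      simp only [squareExp, ← integral_const_mul, mul_assoc]
    · refine hfi.bdd_mul (c := 1) (continuous_squareExp _).aestronglyMeasurable
        (ae_of_all _ fun p => ?_)
      simp
  -- Only countably many `m` occur, so almost every slice has all its coefficients zero and the
  -- one-dimensional result applies to it.
  have hall := ae_all_iff.2 hcoef
  have hae : ∀ᵐ ξ ∂unitMeasure, ∀ᵐ x ∂unitMeasure, f (ξ, x) = 0 := by
    filter_upwards [hall, hslice] with ξ h1 h2
    exact ae_eq_zero_of_integral_unitExp_mul h2 h1
  have hn : ∫ p, ‖f p‖ ^ 2 ∂squareMeasure = 0 := by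
    rw [integral_prod _ hsq]
    refine integral_eq_zero_of_ae ?_
    filter_upwards [hae] with ξ hξ
    refine integral_eq_zero_of_ae ?_
    filter_upwards [hξ] with x hx
    simp [hx]
  rw [integral_eq_zero_iff_of_nonneg (fun x => by positivity) hsq] at hn
  filter_upwards [hn] with x hx
  simpa using hx

theorem memLp_squareExp (k : ℤ × ℤ) (q : ℝ≥0∞) : MemLp (squareExp k) q squareMeasure :=
  MemLp.of_bound (continuous_squareExp k).aestronglyMeasurable 1 (ae_of_all _ fun p => by simp)

/-- `squareExp k` as an element of `L²`. -/
def squareExpLp (k : ℤ × ℤ) : Lp ℂ 2 squareMeasure := (memLp_squareExp k 2).toLp _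

theorem inner_squareExpLp (k : ℤ × ℤ) (F : Lp ℂ 2 squareMeasure) :
    inner ℂ (squareExpLp k) F = ∫ p, squareExp (-k) p * F p ∂squareMeasure := by
  rw [L2.inner_def]
  refine integral_congr_ae ?_
  filter_upwards [(memLp_squareExp k 2).coeFn_toLp] with p hp
  rw [squareExpLp, hp, RCLike.inner_apply, conj_squareExp, mul_comm]

theorem orthonormal_squareExpLp : Orthonormal ℂ squareExpLp := by
  rw [orthonormal_iff_ite]
  intro k l
  rw [inner_squareExpLp]
  have : ∫ p, squareExp (-k) p * squareExpLp l p ∂squareMeasure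
      = ∫ p, squareExp (-k + l) p ∂squareMeasure := by
    refine integral_congr_ae ?_
    filter_upwards [(memLp_squareExp l 2).coeFn_toLp] with p hp
    rw [squareExpLp, hp, squareExp_add]
  rw [this, integral_squareExp]
  have h : -k + l = 0 ↔ k = l := by rw [neg_add_eq_zero]
  simp only [h]

/-- The exponentials form a Hilbert basis of `L²` of the unit square. -/
def squareBasis : HilbertBasis (ℤ × ℤ) ℂ (Lp ℂ 2 squareMeasure) :=
  HilbertBasis.mkOfOrthogonalEqBot orthonormal_squareExpLp (by
    rw [Submodule.eq_bot_iff]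
    intro F hF
    rw [Submodule.mem_orthogonal] at hF
    rw [Lp.eq_zero_iff_ae_eq_zero]
    refine ae_eq_zero_of_integral_squareExp_mul (Lp.memLp F) fun k => ?_
    rw [← neg_neg k, ← inner_squareExpLp]
    exact hF _ (Submodule.subset_span ⟨_, rfl⟩))

@[simp]
theorem squareBasis_apply (k : ℤ × ℤ) : squareBasis k = squareExpLp k := by
  simp [squareBasis]

/-! ### The box Gabor basis and the Zak transform. -/

theorem tfShift_ae_eq (z : ℝ × ℝ) {g : L2R} {u : ℝ → ℂ} (hu : g =ᵐ[volume] u) :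
    tfShift z g =ᵐ[volume] tfShiftFun z u := by
  refine (memLp_tfShiftFun z (Lp.memLp g)).coeFn_toLp.trans ?_
  have := (measurePreserving_sub_right volume z.1).quasiMeasurePreserving.ae_eq_comp hu
  filter_upwards [this] with t ht
  simp only [Function.comp_apply] at ht
  simp only [tfShiftFun, ht]

theorem inner_tfShift_eq_integral (z : ℝ × ℝ) {g f : L2R} {u v : ℝ → ℂ} (hu : g =ᵐ[volume] u)
    (hv : f =ᵐ[volume] v) :
    inner ℂ (tfShift z g) f = ∫ t, conj (tfShiftFun z u t) * v t := by
  rw [L2.inner_def]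
  refine integral_congr_ae ?_
  filter_upwards [tfShift_ae_eq z hu, hv] with t h1 h2
  rw [h1, h2, RCLike.inner_apply, mul_comm]

/-- This is where critical density enters: the modulation frequency `m/a` is dual to the step `a`,
so the phase has period one in `x` and the integer part of the translation drops out. -/
theorem tfShiftFun_lattice {a : ℝ} (ha : 0 < a) (k : ℤ × ℤ) (u : ℝ → ℂ) (x : ℝ) (n : ℤ) :
    tfShiftFun (a * k.1, 1 / a * k.2) u (a * (x + n))
      = unitExp k.2 x * u (a * (x + (n - k.1 : ℤ))) := by
  have ha' : (a : ℂ) ≠ 0 := by exact_mod_cast ha.ne'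
  have h1 : a * (x + n) - a * k.1 = a * (x + (n - k.1 : ℤ)) := by push_cast; ring
  simp only [tfShiftFun, h1]
  congr 1
  rw [← unitExp_add_intCast k.2 x (n - k.1), unitExp]
  congr 1
  push_cast
  field_simp
  ring

/-- The `L²`-normalized indicator function of `(0, a]`. -/
def boxFun (a : ℝ) : ℝ → ℂ := (Ioc 0 a).indicator fun _ => ((√a)⁻¹ : ℂ)

theorem memLp_boxFun (a : ℝ) : MemLp (boxFun a) 2 (volume : Measure ℝ) :=
  memLp_indicator_const 2 measurableSet_Ioc _ (Or.inr (by simp))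

/-- `boxFun a` as an element of `L²`. -/
def boxLp (a : ℝ) : L2R := (memLp_boxFun a).toLp _

theorem boxLp_ae_eq (a : ℝ) : boxLp a =ᵐ[volume] boxFun a := (memLp_boxFun a).coeFn_toLp

theorem boxFun_mul_add {a : ℝ} (ha : 0 < a) {x : ℝ} (hx : x ∈ Ioc (0 : ℝ) 1) (n : ℤ) :
    boxFun a (a * (x + n)) = if n = 0 then ((√a)⁻¹ : ℂ) else 0 := by
  rw [boxFun, indicator_apply]
  congr 1
  simp only [mem_Ioc, eq_iff_iff]
  constructor
  · rintro ⟨h1, h2⟩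
    have h1 : 0 < x + n := pos_of_mul_pos_right h1 ha.le
    have h2 : x + n ≤ 1 := by
      by_contra! h; nlinarith
    have h3 : (-1 : ℝ) < n := by linarith [hx.2]
    have h4 : (n : ℝ) < 1 := by linarith [hx.1]
    have h3' : -1 < n := by exact_mod_cast h3
    have h4' : n < 1 := by exact_mod_cast h4
    omega
  · rintro rfl
    simp only [Int.cast_zero, add_zero]
    exact ⟨mul_pos ha hx.1, by nlinarith [hx.2]⟩

theorem integral_eq_mul_integral_comp_mul_add {a : ℝ} (ha : 0 < a) (F : ℝ → ℂ) (n : ℤ) :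
    ∫ t, F t = a * ∫ x, F (a * (x + n)) := by
  rw [integral_add_right_eq_self (fun x : ℝ => F (a * x)) (n : ℝ), Measure.integral_comp_mul_left,
    abs_of_pos (inv_pos.2 ha), Complex.real_smul, ← mul_assoc, ← Complex.ofReal_mul,
    mul_inv_cancel₀ ha.ne']
  simp

/-- The translated box isolates the cell `a(n, n + 1]` with `n = k.1`, so the coefficients are the
Fourier coefficients of `v` on the separate cells, rescaled to the unit interval. -/
theorem inner_gaborSystem_boxLp {a : ℝ} (ha : 0 < a) (k : ℤ × ℤ) {f : L2R} {v : ℝ → ℂ}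
    (hv : f =ᵐ[volume] v) :
    inner ℂ (gaborSystem (boxLp a) a (1 / a) k) f
      = √a * ∫ x, unitExp (-k.2) x * v (a * (x + k.1)) ∂unitMeasure := by
  rw [gaborSystem, inner_tfShift_eq_integral _ (boxLp_ae_eq a) hv,
    integral_eq_mul_integral_comp_mul_add ha _ k.1]
  have h1 : ∀ x : ℝ, conj (tfShiftFun (a * k.1, 1 / a * k.2) (boxFun a) (a * (x + k.1)))
        * v (a * (x + k.1))
      = (Ioc (0 : ℝ) 1).indicator
        (fun x => ((√a)⁻¹ : ℂ) * (unitExp (-k.2) x * v (a * (x + k.1)))) x := by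
    intro x
    rw [tfShiftFun_lattice ha, sub_self]
    by_cases hx : x ∈ Ioc (0 : ℝ) 1
    · rw [boxFun_mul_add ha hx, indicator_of_mem hx, if_pos rfl, map_mul, conj_unitExp, map_inv₀,
        Complex.conj_ofReal]
      ring
    · have : boxFun a (a * (x + (0 : ℤ))) = 0 := by
        rw [boxFun, indicator_of_notMem]
        intro h
        apply hx
        simp only [Int.cast_zero, add_zero, mem_Ioc] at h
        exact ⟨pos_of_mul_pos_right h.1 ha.le, by by_contra! h'; nlinarith [h.2]⟩
      rw [this, indicator_of_notMem hx]
      simp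
  simp only [h1]
  rw [integral_indicator measurableSet_Ioc, integral_const_mul, ← mul_assoc]
  congr 1
  have : (a : ℂ) = √a * √a := by exact_mod_cast (Real.mul_self_sqrt ha.le).symm
  have h0 : (√a : ℂ) ≠ 0 := by exact_mod_cast (Real.sqrt_pos.2 ha).ne'
  conv_lhs => rw [this]
  field_simp

/-- The critical lattice shifts compose without a phase factor, so a shift of `f` merely translates
the coefficient index. -/
theorem inner_gaborSystem_boxLp_tfShift {a : ℝ} (ha : 0 < a) (k l : ℤ × ℤ) (f : L2R) :
    inner ℂ (gaborSystem (boxLp a) a (1 / a) l) (gaborSystem f a (1 / a) k)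
      = inner ℂ (gaborSystem (boxLp a) a (1 / a) (l - k)) f := by
  rw [inner_gaborSystem_boxLp ha l (f := gaborSystem f a (1 / a) k)
      (tfShift_ae_eq _ (ae_eq_refl f)),
    inner_gaborSystem_boxLp ha _ (ae_eq_refl f)]
  congr 1
  refine integral_congr_ae (ae_of_all _ fun x => ?_)
  simp only
  rw [tfShiftFun_lattice ha, ← mul_assoc, ← unitExp_add]
  congr 2
  simp only [Prod.snd_sub]
  ring

theorem orthonormal_gaborSystem_boxLp {a : ℝ} (ha : 0 < a) :
    Orthonormal ℂ (gaborSystem (boxLp a) a (1 / a)) := by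
  rw [orthonormal_iff_ite]
  intro k l
  rw [inner_gaborSystem_boxLp_tfShift ha,
    inner_gaborSystem_boxLp ha _ (boxLp_ae_eq a)]
  have h1 : ∫ x, unitExp (-(k - l).2) x * boxFun a (a * (x + (k - l).1)) ∂unitMeasure
      = ∫ x, unitExp (-(k - l).2) x * (if (k - l).1 = 0 then ((√a)⁻¹ : ℂ) else 0) ∂unitMeasure := by
    refine setIntegral_congr_fun measurableSet_Ioc fun x hx => ?_
    simp only [boxFun_mul_add ha hx]
  rw [h1, integral_mul_const, integral_unitExp]
  have h0 : (√a : ℂ) ≠ 0 := by exact_mod_cast (Real.sqrt_pos.2 ha).ne'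
  have h2 : k = l ↔ (k - l).1 = 0 ∧ -(k - l).2 = 0 := by
    rw [← sub_eq_zero, Prod.ext_iff, neg_eq_zero]; rfl
  simp only [h2]
  split_ifs <;> simp_all

theorem eq_zero_of_inner_gaborSystem_boxLp {a : ℝ} (ha : 0 < a) {f : L2R}
    (h : ∀ k, inner ℂ (gaborSystem (boxLp a) a (1 / a) k) f = 0) : f = 0 := by
  have h0 : (√a : ℂ) ≠ 0 := by exact_mod_cast (Real.sqrt_pos.2 ha).ne'
  have hsq : Integrable (fun t => ‖f t‖ ^ 2) :=
    (memLp_two_iff_integrable_sq_norm (Lp.memLp f).1).1 (Lp.memLp f)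
  have h1 : ∀ n : ℤ, ∀ᵐ x : ℝ, x ∈ Ioc (0 : ℝ) 1 → f (a * (x + n)) = 0 := by
    intro n
    rw [← ae_restrict_iff' measurableSet_Ioc]
    refine ae_eq_zero_of_integral_unitExp_mul (f := fun x => f (a * (x + n))) ?_ fun m => ?_
    · have hm : AEStronglyMeasurable (fun x : ℝ => f (a * (x + n))) unitMeasure :=
        ((Lp.stronglyMeasurable f).comp_measurable (by fun_prop)).aestronglyMeasurable
      rw [memLp_two_iff_integrable_sq_norm hm]
      exact ((hsq.comp_mul_left' ha.ne').comp_add_right (n : ℝ)).restrict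
    · have := h (n, -m)
      rw [inner_gaborSystem_boxLp ha _ (ae_eq_refl f)] at this
      simpa [h0] using this
  have h2 : ∀ n : ℤ, ∀ᵐ y : ℝ, y - n ∈ Ioc (0 : ℝ) 1 → f (a * y) = 0 := by
    intro n
    have := (measurePreserving_sub_right (volume : Measure ℝ) n).quasiMeasurePreserving.ae (h1 n)
    filter_upwards [this] with y hy hy'
    simpa using hy hy'
  have h3 : ∀ᵐ y : ℝ, f (a * y) = 0 := by
    filter_upwards [ae_all_iff.2 h2] with y hy
    -- The cells `(n, n + 1]` are open on the left, hence the ceiling minus one and not the floor.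
    refine hy (⌈y⌉ - 1) ⟨?_, ?_⟩
    · push_cast; linarith [Int.ceil_lt_add_one y]
    · push_cast; linarith [Int.le_ceil y]
  have h4 : ∫ t, ‖f t‖ ^ 2 = 0 := by
    have h5 := Measure.integral_comp_mul_left (fun t => ‖f t‖ ^ 2) a
    have h6 : ∫ x, ‖f (a * x)‖ ^ 2 = 0 := by
      refine integral_eq_zero_of_ae ?_
      filter_upwards [h3] with y hy
      simp [hy]
    rw [h6] at h5
    simpa [ha.ne'] using h5.symm
  rw [integral_eq_zero_iff_of_nonneg (fun x => by positivity) hsq] at h4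
  rw [Lp.eq_zero_iff_ae_eq_zero]
  filter_upwards [h4] with x hx
  simpa using hx

/-- The Gabor system of the normalized indicator function of `(0, a]` is a Hilbert basis. -/
def boxBasis {a : ℝ} (ha : 0 < a) : HilbertBasis (ℤ × ℤ) ℂ L2R :=
  HilbertBasis.mkOfOrthogonalEqBot (orthonormal_gaborSystem_boxLp ha) (by
    rw [Submodule.eq_bot_iff]
    intro f hf
    rw [Submodule.mem_orthogonal] at hf
    exact eq_zero_of_inner_gaborSystem_boxLp ha fun k => hf _ (Submodule.subset_span ⟨k, rfl⟩))

/-- The Zak transform with parameter `a`, as a unitary map onto `L²` of the unit square. -/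
def zak {a : ℝ} (ha : 0 < a) : L2R ≃ₗᵢ[ℂ] Lp ℂ 2 squareMeasure :=
  (boxBasis ha).repr.trans squareBasis.repr.symm

theorem inner_squareExpLp_zak {a : ℝ} (ha : 0 < a) (k : ℤ × ℤ) (f : L2R) :
    inner ℂ (squareExpLp k) (zak ha f) = inner ℂ (gaborSystem (boxLp a) a (1 / a) k) f := by
  rw [← squareBasis_apply, ← HilbertBasis.repr_apply_apply]
  simp only [zak, LinearIsometryEquiv.trans_apply, LinearIsometryEquiv.apply_symm_apply]
  rw [HilbertBasis.repr_apply_apply]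
  simp [boxBasis]

/-- A square-integrable function with the Fourier coefficients of the Zak transform of `f` is
the Zak transform of `f`. -/
theorem zak_ae_eq_of_integral_eq {a : ℝ} (ha : 0 < a) {f : L2R} {F : ℝ × ℝ → ℂ}
    (hF : MemLp F 2 squareMeasure)
    (h : ∀ k, ∫ p, squareExp (-k) p * F p ∂squareMeasure
      = inner ℂ (gaborSystem (boxLp a) a (1 / a) k) f) :
    zak ha f =ᵐ[squareMeasure] F := by
  have hint : ∀ {u : ℝ × ℝ → ℂ} (k), MemLp u 2 squareMeasure →
      Integrable (fun p => squareExp k p * u p) squareMeasure := fun k hu =>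
    (hu.integrable (by norm_num)).bdd_mul (c := 1) (continuous_squareExp k).aestronglyMeasurable
      (ae_of_all _ fun p => by simp)
  have : (fun p => zak ha f p - F p) =ᵐ[squareMeasure] 0 := by
    refine ae_eq_zero_of_integral_squareExp_mul ((Lp.memLp _).sub hF) fun k => ?_
    simp only [mul_sub]
    rw [integral_sub (hint k (Lp.memLp _)) (hint k hF), sub_eq_zero]
    rw [← neg_neg k, h, ← inner_squareExpLp_zak ha, inner_squareExpLp]
  filter_upwards [this] with p hp
  exact sub_eq_zero.1 hp

/-- The Zak transform turns the Gabor system at critical density into multiplication by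
exponentials. -/
theorem zak_gaborSystem {a : ℝ} (ha : 0 < a) (k : ℤ × ℤ) (f : L2R) :
    zak ha (gaborSystem f a (1 / a) k) =ᵐ[squareMeasure]
      fun p => squareExp k p * zak ha f p := by
  refine zak_ae_eq_of_integral_eq ha ?_ fun l => ?_
  · refine (Lp.memLp (zak ha f)).of_le
      ((continuous_squareExp k).aestronglyMeasurable.mul (Lp.memLp (zak ha f)).1)
      (ae_of_all _ fun p => by simp)
  · rw [inner_gaborSystem_boxLp_tfShift ha, ← inner_squareExpLp_zak ha, inner_squareExpLp]
    simp only [← mul_assoc, ← squareExp_add]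
    rw [show -l + k = -(l - k) by abel]

/-! ### Reproducing pairs as multiplication operators. -/

theorem HasSum.of_unconditional {ι M : Type*} [AddCommMonoid M] [TopologicalSpace M] {f : ι → M}
    {s : M} (h : HasSum f s) (L : SummationFilter ι) [L.LeAtTop] : HasSum f s L := by
  unfold HasSum at h ⊢
  rw [SummationFilter.unconditional_filter] at h
  exact h.mono_left L.le_atTop

/-- The coefficient functionals of two families obtained from a Hilbert basis by multiplication
with `G` and `Γ` synthesize the operator of multiplication with `conj G * Γ`. -/
theorem inner_eq_inner_of_hasSum {Ω ι : Type*} [MeasurableSpace Ω] {μ : Measure Ω}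
    {e : HilbertBasis ι ℂ (Lp ℂ 2 μ)} {G Γ : Lp ℂ 2 μ} {ψ φ : ι → Lp ℂ 2 μ}
    (hψ : ∀ k, ψ k =ᵐ[μ] fun p => e k p * G p) (hφ : ∀ k, φ k =ᵐ[μ] fun p => e k p * Γ p)
    {L : SummationFilter ι} [L.NeBot] [L.LeAtTop] {F H X Y : Lp ℂ 2 μ} {s : ℂ}
    (hs : HasSum (fun k => inner ℂ (ψ k) F * inner ℂ H (φ k)) s L)
    (hX : X =ᵐ[μ] fun p => conj (Γ p) * H p) (hY : Y =ᵐ[μ] fun p => conj (G p) * F p) :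
    s = inner ℂ X Y := by
  have h1 : ∀ k, inner ℂ (ψ k) F = inner ℂ (e k) Y := by
    intro k
    rw [L2.inner_def, L2.inner_def]
    refine integral_congr_ae ?_
    filter_upwards [hψ k, hY] with p hp1 hp2
    rw [hp1, hp2]
    simp only [RCLike.inner_apply, map_mul]
    ring
  have h2 : ∀ k, inner ℂ H (φ k) = inner ℂ X (e k) := by
    intro k
    rw [L2.inner_def, L2.inner_def]
    refine integral_congr_ae ?_
    filter_upwards [hφ k, hX] with p hp1 hp2
    rw [hp1, hp2]
    simp only [RCLike.inner_apply, map_mul, Complex.conj_conj]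
    ring
  refine hs.unique ?_
  simp only [h1, h2]
  simpa only [mul_comm] using (e.hasSum_inner_mul_inner X Y).of_unconditional L

/-- `S` acts as multiplication by `conj G * Γ`. If this product were too small on a set of positive
measure, `S` would shrink the indicator of a part of that set more than its bounded inverse allows.
Since neither `G` nor `Γ` is assumed bounded, both are truncated. -/
theorem exists_le_norm_mul_norm_of_hasSum {Ω ι : Type*} [MeasurableSpace Ω] {μ : Measure Ω}
    [IsFiniteMeasure μ] {e : HilbertBasis ι ℂ (Lp ℂ 2 μ)} {G Γ : Lp ℂ 2 μ} {ψ φ : ι → Lp ℂ 2 μ}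
    (hψ : ∀ k, ψ k =ᵐ[μ] fun p => e k p * G p) (hφ : ∀ k, φ k =ᵐ[μ] fun p => e k p * Γ p)
    {L : SummationFilter ι} [L.NeBot] [L.LeAtTop] (S : Lp ℂ 2 μ ≃L[ℂ] Lp ℂ 2 μ)
    (hS : ∀ F H, HasSum (fun k => inner ℂ (ψ k) F * inner ℂ H (φ k)) (inner ℂ H (S F)) L) :
    ∃ c : ℝ, 0 < c ∧ ∀ᵐ p ∂μ, c ≤ ‖G p‖ * ‖Γ p‖ := by
  obtain ⟨K, hKpos, hK⟩ : ∃ K : ℝ, 0 < K ∧ ∀ F, ‖F‖ ≤ K * ‖S F‖ := by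
    refine ⟨‖(S.symm : Lp ℂ 2 μ →L[ℂ] Lp ℂ 2 μ)‖ + 1, by positivity, fun F => ?_⟩
    have h := (S.symm : Lp ℂ 2 μ →L[ℂ] Lp ℂ 2 μ).le_opNorm (S F)
    simp only [ContinuousLinearEquiv.coe_coe, ContinuousLinearEquiv.symm_apply_apply] at h
    nlinarith [norm_nonneg (S F)]
  -- With this `c`, a function supported where the product is below `c` satisfies `K * ‖S F‖ ≤ ‖F‖ /
  -- 2`, which together with `hK` leaves only `F = 0`.
  set c : ℝ := (2 * K)⁻¹ with hc
  have hcpos : 0 < c := by positivity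
  refine ⟨c, hcpos, ?_⟩
  have hGm : Measurable G := (Lp.stronglyMeasurable G).measurable
  have hΓm : Measurable Γ := (Lp.stronglyMeasurable Γ).measurable
  have key : ∀ N : ℕ, ∀ᵐ p ∂μ, ‖G p‖ ≤ N → c ≤ ‖G p‖ * ‖Γ p‖ := by
    intro N
    -- The bound by `N` makes `conj G * F` square integrable, as Parseval requires.
    set A : Set Ω := {p | ‖G p‖ ≤ N ∧ ‖G p‖ * ‖Γ p‖ < c} with hA
    have hAm : MeasurableSet A :=
      (measurableSet_le hGm.norm measurable_const).inter
        (measurableSet_lt (hGm.norm.mul hΓm.norm) measurable_const)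
    set F : Lp ℂ 2 μ := indicatorConstLp 2 hAm (measure_ne_top μ A) (1 : ℂ) with hF
    have hFae : F =ᵐ[μ] A.indicator fun _ => (1 : ℂ) := indicatorConstLp_coeFn
    have hYL : MemLp (fun p => conj (G p) * F p) 2 μ := by
      refine MemLp.of_le_mul (c := N) (Lp.memLp F)
        (Complex.continuous_conj.comp_aestronglyMeasurable (Lp.memLp G).1 |>.mul (Lp.memLp F).1) ?_
      filter_upwards [hFae] with p hp
      rw [hp, norm_mul, RCLike.norm_conj]
      by_cases h : p ∈ A
      · exact mul_le_mul_of_nonneg_right h.1 (norm_nonneg _)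
      · simp [h]
    have hWb : ∀ᵐ p ∂μ, ‖Γ p * (conj (G p) * F p)‖ ≤ c * ‖F p‖ := by
      filter_upwards [hFae] with p hp
      rw [hp, norm_mul, norm_mul, RCLike.norm_conj]
      by_cases h : p ∈ A
      · rw [← mul_assoc, mul_comm ‖Γ p‖]
        exact mul_le_mul_of_nonneg_right h.2.le (norm_nonneg _)
      · simp [h]
    have hWL : MemLp (fun p => Γ p * (conj (G p) * F p)) 2 μ :=
      MemLp.of_le_mul (Lp.memLp F) ((Lp.memLp Γ).1.mul hYL.1) hWb
    have hSF : S F = hWL.toLp _ := by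
      rw [← sub_eq_zero, Lp.eq_zero_iff_ae_eq_zero]
      set u := S F - hWL.toLp _ with hu
      -- Testing `u` against its own restriction to `{‖Γ‖ ≤ M}` keeps `conj Γ * H` in `L²`; these
      -- sets exhaust the space.
      have hloc : ∀ M : ℕ, ∀ᵐ p ∂μ, ‖Γ p‖ ≤ M → u p = 0 := by
        intro M
        have hBm : MeasurableSet {p | ‖Γ p‖ ≤ M} := measurableSet_le hΓm.norm measurable_const
        have hHL : MemLp ({p | ‖Γ p‖ ≤ M}.indicator u) 2 μ := (Lp.memLp u).indicator hBm
        set H := hHL.toLp _ with hH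
        have hHae : H =ᵐ[μ] {p | ‖Γ p‖ ≤ M}.indicator u := hHL.coeFn_toLp
        have hXL : MemLp (fun p => conj (Γ p) * H p) 2 μ := by
          refine MemLp.of_le_mul (c := M) (Lp.memLp H)
            (Complex.continuous_conj.comp_aestronglyMeasurable (Lp.memLp Γ).1 |>.mul
              (Lp.memLp H).1) ?_
          filter_upwards [hHae] with p hp
          rw [hp, norm_mul, RCLike.norm_conj]
          by_cases h : ‖Γ p‖ ≤ M
          · exact mul_le_mul_of_nonneg_right h (norm_nonneg _)
          · simp [h]
        have h1 : inner ℂ H (S F) = inner ℂ H (hWL.toLp _) := by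
          rw [inner_eq_inner_of_hasSum hψ hφ (hS F H) hXL.coeFn_toLp hYL.coeFn_toLp,
            L2.inner_def, L2.inner_def]
          refine integral_congr_ae ?_
          filter_upwards [hXL.coeFn_toLp, hYL.coeFn_toLp, hWL.coeFn_toLp] with p h1 h2 h3
          rw [h1, h2, h3]
          simp only [RCLike.inner_apply, map_mul, Complex.conj_conj]
          ring
        have h2 : inner ℂ H H = inner ℂ H u := by
          rw [L2.inner_def, L2.inner_def]
          refine integral_congr_ae ?_
          filter_upwards [hHae] with p hp
          rw [hp]
          by_cases h : p ∈ {p | ‖Γ p‖ ≤ M}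
          · simp [indicator_of_mem h]
          · simp [indicator_of_notMem h]
        rw [hu, inner_sub_right, h1, sub_self, inner_self_eq_zero,
          Lp.eq_zero_iff_ae_eq_zero] at h2
        filter_upwards [h2, hHae] with p hp1 hp2 hp3
        rw [hp1, indicator_of_mem (by exact hp3)] at hp2
        exact hp2.symm
      filter_upwards [ae_all_iff.2 hloc] with p hp
      obtain ⟨M, hM⟩ := exists_nat_ge ‖Γ p‖
      exact hp M hM
    have hle : ‖S F‖ ≤ c * ‖F‖ := by
      rw [hSF]
      refine Lp.norm_le_mul_norm_of_ae_le_mul ?_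
      filter_upwards [hWL.coeFn_toLp, hWb] with p h1 h2
      rwa [h1]
    have hF0 : F = 0 := by
      have h1 := hK F
      have h2 : K * ‖S F‖ ≤ ‖F‖ / 2 := by
        calc K * ‖S F‖ ≤ K * (c * ‖F‖) := mul_le_mul_of_nonneg_left hle hKpos.le
          _ = ‖F‖ / 2 := by rw [hc]; field_simp
      rw [← norm_eq_zero]
      linarith [norm_nonneg F]
    rw [Lp.eq_zero_iff_ae_eq_zero] at hF0
    filter_upwards [hF0, hFae] with p h1 h2 h3
    by_contra! h4
    rw [h1, indicator_of_mem (show p ∈ A from ⟨h3, h4⟩)] at h2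
    simp at h2
  filter_upwards [ae_all_iff.2 key] with p hp
  obtain ⟨N, hN⟩ := exists_nat_ge ‖G p‖
  exact hp N hN

/-- If two Gabor systems at critical density form a reproducing pair, the product of the Zak
transforms of their generators is bounded away from zero. -/
theorem exists_le_norm_zak_mul_norm_zak {a : ℝ} (ha : 0 < a) {g γ : L2R}
    {L : SummationFilter (ℤ × ℤ)} [L.NeBot] [L.LeAtTop]
    (hpair : IsReproducingPair (gaborSystem g a (1 / a)) (gaborSystem γ a (1 / a)) L) :
    ∃ c : ℝ, 0 < c ∧ ∀ᵐ p ∂squareMeasure, c ≤ ‖zak ha g p‖ * ‖zak ha γ p‖ := by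
  obtain ⟨S, hS⟩ := hpair
  have hZ : ∀ (f : L2R) (k : ℤ × ℤ), zak ha (gaborSystem f a (1 / a) k) =ᵐ[squareMeasure]
      fun p => squareBasis k p * zak ha f p := by
    intro f k
    filter_upwards [zak_gaborSystem ha k f, (memLp_squareExp k 2).coeFn_toLp] with p h1 h2
    rw [h1, squareBasis_apply, squareExpLp, h2]
  let Z := (zak ha).toContinuousLinearEquiv
  refine exists_le_norm_mul_norm_of_hasSum (hZ g) (hZ γ) (L := L) ((Z.symm.trans S).trans Z)
    fun F H => ?_
  have h := hS ((zak ha).symm F) ((zak ha).symm H)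
  have h1 : ∀ f : L2R, inner ℂ ((zak ha).symm H) f = inner ℂ H (zak ha f) := by
    intro f
    rw [← (zak ha).inner_map_map, (zak ha).apply_symm_apply]
  have h2 : ∀ f : L2R, inner ℂ f ((zak ha).symm F) = inner ℂ (zak ha f) F := by
    intro f
    rw [← (zak ha).inner_map_map, (zak ha).apply_symm_apply]
  simp only [h1, h2] at h
  exact h

/-! ### Zeros of quasi-periodic functions. -/

/-- The values lie in the discrete set `2πiℤ`, and an interval is connected. -/
theorem eq_of_exp_eq_one {f : ℝ → ℂ} {a b : ℝ} (hab : a ≤ b) (hf : ContinuousOn f (Icc a b))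
    (h : ∀ x ∈ Icc a b, Complex.exp (f x) = 1) : f a = f b := by
  have h1 : ∀ x ∈ Icc a b, ∃ n : ℤ, f x = n * (2 * Real.pi * Complex.I) := fun x hx =>
    Complex.exp_eq_one_iff.1 (h x hx)
  have hd : IsDiscrete (range ((↑) : ℤ → ℝ)) := by
    rw [isDiscrete_iff_discreteTopology]
    exact (Int.isClosedEmbedding_coe_real.isEmbedding.toHomeomorph).discreteTopology_iff.1
      inferInstance
  have h2 : (f a).im / (2 * Real.pi) = (f b).im / (2 * Real.pi) := by
    refine isPreconnected_Icc.constant_of_mapsTo hd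
      (f := fun x => (f x).im / (2 * Real.pi)) ?_ ?_ (left_mem_Icc.2 hab) (right_mem_Icc.2 hab)
    · exact (Complex.continuous_im.comp_continuousOn hf).div_const _
    · intro x hx
      obtain ⟨n, hn⟩ := h1 x hx
      refine ⟨n, ?_⟩
      simp only [hn]
      field_simp
      simp [mul_comm, mul_left_comm]
  obtain ⟨n, hn⟩ := h1 a (left_mem_Icc.2 hab)
  obtain ⟨m, hm⟩ := h1 b (right_mem_Icc.2 hab)
  rw [hn, hm] at h2 ⊢
  congr 2
  simpa [Real.pi_ne_zero] using h2

/-- A continuous quasi-periodic function on the unit square has a zero. -/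
theorem exists_eq_zero_of_quasiperiodic {G : ℝ × ℝ → ℂ}
    (hG : ContinuousOn G (Icc 0 1 ×ˢ Icc 0 1))
    (h1 : ∀ ξ ∈ Icc (0 : ℝ) 1, G (ξ, 1) = unitExp (-1) ξ * G (ξ, 0))
    (h2 : ∀ x ∈ Icc (0 : ℝ) 1, G (1, x) = G (0, x)) :
    ∃ p ∈ Icc (0 : ℝ) 1 ×ˢ Icc (0 : ℝ) 1, G p = 0 := by
  by_contra! hne
  -- Clamping the coordinates extends `G` without zeros to the whole plane, where a continuous
  -- logarithm exists by lifting through the covering `exp`.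
  let pr : ℝ → ℝ := fun x => projIcc (0 : ℝ) 1 zero_le_one x
  have hpr : Continuous pr := continuous_subtype_val.comp continuous_projIcc
  have hprm : ∀ x, pr x ∈ Icc (0 : ℝ) 1 := fun x => (projIcc (0 : ℝ) 1 zero_le_one x).2
  have hprid : ∀ x ∈ Icc (0 : ℝ) 1, pr x = x := fun x hx => by simp [pr, projIcc_of_mem _ hx]
  let F : C(ℝ × ℝ, ℂ) := ⟨fun p => G (pr p.1, pr p.2),
    hG.comp_continuous (by fun_prop) fun p => ⟨hprm _, hprm _⟩⟩
  have hF : ∀ p, F p ≠ 0 := fun p => hne _ ⟨hprm _, hprm _⟩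
  obtain ⟨H, ⟨-, hH⟩, -⟩ := Complex.isCoveringMapOn_exp.existsUnique_continuousMap_lifts F
    (a₀ := (0, 0)) (Complex.exp_log (hF _)) (fun p => hF p)
  have hexp : ∀ p ∈ Icc (0 : ℝ) 1 ×ˢ Icc (0 : ℝ) 1, Complex.exp (H p) = G p := by
    rintro ⟨x, y⟩ ⟨hx, hy⟩
    have := congr_fun hH (x, y)
    simp only [Function.comp_apply, F, ContinuousMap.coe_mk] at this
    rwa [hprid x hx, hprid y hy] at this
  have m0 : (0 : ℝ) ∈ Icc (0 : ℝ) 1 := by simp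
  have m1 : (1 : ℝ) ∈ Icc (0 : ℝ) 1 := by simp
  -- Quasi-periodicity says that the change of the logarithm from the bottom to the top edge is
  -- `-2πiξ` up to a constant in `2πiℤ`; between the vertical edges it is constant. Comparing the
  -- four corners yields `2πi = 0`.
  have e1 := eq_of_exp_eq_one zero_le_one
    (f := fun ξ : ℝ => H (ξ, 1) - H (ξ, 0) + 2 * Real.pi * Complex.I * ξ)
    (by fun_prop) (by
      intro ξ hξ
      rw [Complex.exp_add, Complex.exp_sub, hexp _ ⟨hξ, m1⟩, hexp _ ⟨hξ, m0⟩, h1 ξ hξ,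
        mul_div_assoc, div_self (hne _ ⟨hξ, m0⟩), mul_one, unitExp, ← Complex.exp_add]
      simp)
  have e2 := eq_of_exp_eq_one zero_le_one (f := fun x : ℝ => H (1, x) - H (0, x))
    (by fun_prop) (by
      intro x hx
      rw [Complex.exp_sub, hexp _ ⟨m1, hx⟩, hexp _ ⟨m0, hx⟩, h2 x hx,
        div_self (hne _ ⟨m0, hx⟩)])
  have e3 : (2 * Real.pi * Complex.I : ℂ) = 0 := by
    simp only [Complex.ofReal_zero, Complex.ofReal_one, mul_zero, mul_one, add_zero] at e1 e2
    linear_combination e2 - e1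
  simp [Real.pi_ne_zero] at e3

/-! ### Failure of square integrability near a Lipschitz zero. -/

/-- Even when centred at an endpoint, a ball of radius at most one keeps half of its length inside
the interval. -/
theorem le_measureReal_closedBall_unitMeasure {x r : ℝ} (hx : x ∈ Icc (0 : ℝ) 1) (hr : 0 ≤ r)
    (hr1 : r ≤ 1) : r ≤ unitMeasure.real (Metric.closedBall x r) := by
  rw [measureReal_restrict_apply Metric.isClosed_closedBall.measurableSet,
    Real.closedBall_eq_Icc]
  have hsub : Ioc (max 0 (x - r)) (min 1 (x + r)) ⊆ Icc (x - r) (x + r) ∩ Ioc 0 1 := by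
    rintro y ⟨h1, h2⟩
    simp only [max_lt_iff, le_min_iff] at h1 h2
    exact ⟨⟨h1.2.le, h2.2⟩, h1.1, h2.1⟩
  have h3 : volume.real (Ioc (max 0 (x - r)) (min 1 (x + r)))
      ≤ volume.real (Icc (x - r) (x + r) ∩ Ioc 0 1) :=
    measureReal_mono hsub (ne_top_of_le_ne_top (by simp) (measure_mono inter_subset_right))
  refine le_trans ?_ h3
  have h4 : r ≤ min 1 (x + r) - max 0 (x - r) := by
    rcases max_cases 0 (x - r) with h | h <;> rcases min_cases 1 (x + r) with h' | h' <;>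
      linarith [hx.1, hx.2]
  rw [Real.volume_real_Ioc_of_le (by linarith)]
  exact h4

theorem sq_le_measureReal_closedBall_squareMeasure {p : ℝ × ℝ} {r : ℝ}
    (hp : p ∈ Icc (0 : ℝ) 1 ×ˢ Icc (0 : ℝ) 1) (hr : 0 ≤ r) (hr1 : r ≤ 1) :
    r ^ 2 ≤ squareMeasure.real (Metric.closedBall p r) := by
  rw [← Prod.mk.eta (p := p), ← closedBall_prod_same, measureReal_prod_prod, sq]
  exact mul_le_mul (le_measureReal_closedBall_unitMeasure hp.1 hr hr1)
    (le_measureReal_closedBall_unitMeasure hp.2 hr hr1) hr measureReal_nonneg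

/-- If `G` is Lipschitz and has a zero in the unit square, then `1 / G` is not bounded by a
multiple of a square-integrable function. -/
theorem not_ae_le_norm_mul_norm_of_lipschitz {G Γ : ℝ × ℝ → ℂ} {C c : ℝ} {p₀ : ℝ × ℝ}
    (hG : ∀ p ∈ Icc (0 : ℝ) 1 ×ˢ Icc (0 : ℝ) 1, ‖G p - G p₀‖ ≤ C * dist p p₀)
    (hp₀ : p₀ ∈ Icc (0 : ℝ) 1 ×ˢ Icc (0 : ℝ) 1) (h0 : G p₀ = 0) (hΓ : MemLp Γ 2 squareMeasure)
    (hc : 0 < c) : ¬ ∀ᵐ p ∂squareMeasure, c ≤ ‖G p‖ * ‖Γ p‖ := by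
  intro hae
  have hsq : Integrable (fun p => ‖Γ p‖ ^ 2) squareMeasure :=
    (memLp_two_iff_integrable_sq_norm hΓ.1).1 hΓ
  set D : ℝ := |C| + 1 with hD
  have hDpos : 0 < D := by positivity
  have hmem : ∀ᵐ p ∂squareMeasure, p ∈ Icc (0 : ℝ) 1 ×ˢ Icc (0 : ℝ) 1 := by
    have : ∀ᵐ p ∂squareMeasure, p ∈ Ioc (0 : ℝ) 1 ×ˢ Ioc (0 : ℝ) 1 := by
      rw [squareMeasure, Measure.prod_restrict]
      exact ae_restrict_mem (measurableSet_Ioc.prod measurableSet_Ioc)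
    filter_upwards [this] with p hp
    exact ⟨Ioc_subset_Icc_self hp.1, Ioc_subset_Icc_self hp.2⟩
  -- On the ball `|Γ| ≥ c / (D r)`, and its measure is at least `r ^ 2`, so the powers of `r`
  -- cancel. This uniform bound contradicts the vanishing of the integrals as the balls shrink to a
  -- point.
  have hlow : ∀ r : ℝ, 0 < r → r ≤ 1 →
      (c / D) ^ 2 ≤ ∫ p in Metric.closedBall p₀ r, ‖Γ p‖ ^ 2 ∂squareMeasure := by
    intro r hr hr1
    have h1 : ∫ _ in Metric.closedBall p₀ r, (c / (D * r)) ^ 2 ∂squareMeasure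
        ≤ ∫ p in Metric.closedBall p₀ r, ‖Γ p‖ ^ 2 ∂squareMeasure := by
      refine setIntegral_mono_on_ae (integrable_const _).integrableOn hsq.integrableOn
        Metric.isClosed_closedBall.measurableSet ?_
      filter_upwards [hae, hmem] with p hp1 hp2 hp3
      have h2 := hG p hp2
      rw [h0, sub_zero] at h2
      have h3 : ‖G p‖ ≤ D * r := h2.trans (mul_le_mul (by rw [hD]; linarith [le_abs_self C])
        (Metric.mem_closedBall.1 hp3) dist_nonneg hDpos.le)
      refine pow_le_pow_left₀ (by positivity) ?_ 2
      rw [div_le_iff₀ (by positivity), mul_comm]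
      exact hp1.trans (mul_le_mul_of_nonneg_right h3 (norm_nonneg _))
    refine le_trans ?_ h1
    rw [setIntegral_const, smul_eq_mul]
    calc (c / D) ^ 2 = r ^ 2 * (c / (D * r)) ^ 2 := by field_simp
      _ ≤ _ := mul_le_mul_of_nonneg_right
        (sq_le_measureReal_closedBall_squareMeasure hp₀ hr.le hr1) (by positivity)
  have hlim := tendsto_setIntegral_of_antitone (μ := squareMeasure) (f := fun p => ‖Γ p‖ ^ 2)
    (s := fun n : ℕ => Metric.closedBall p₀ (1 / ((n : ℝ) + 1)))
    (fun n => Metric.isClosed_closedBall.measurableSet)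
    (fun m n hmn => Metric.closedBall_subset_closedBall (Nat.one_div_le_one_div hmn))
    ⟨0, hsq.integrableOn⟩
  have hinter : ⋂ n : ℕ, Metric.closedBall p₀ (1 / ((n : ℝ) + 1)) = {p₀} := by
    ext p
    simp only [mem_iInter, Metric.mem_closedBall, mem_singleton_iff]
    refine ⟨fun h => ?_, fun h => by rw [h, dist_self]; intro i; positivity⟩
    have := ge_of_tendsto' tendsto_one_div_add_atTop_nhds_zero_nat h
    exact dist_le_zero.1 this
  rw [hinter, setIntegral_measure_zero _ (measure_singleton p₀)] at hlim
  have := ge_of_tendsto' hlim fun n : ℕ => hlow (1 / ((n : ℝ) + 1)) (by positivity)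
    (by rw [div_le_one (by positivity)]; linarith [n.cast_nonneg (α := ℝ)])
  have : 0 < (c / D) ^ 2 := by positivity
  linarith

/-! ### Inversion of the short-time Fourier transform. -/

theorem norm_tfShiftFun (z : ℝ × ℝ) (u : ℝ → ℂ) (t : ℝ) : ‖tfShiftFun z u t‖ = ‖u (t - z.1)‖ := by
  have h : (2 * Real.pi * Complex.I * z.2 * (t - z.1) : ℂ)
      = ((2 * Real.pi * z.2 * (t - z.1) : ℝ) : ℂ) * Complex.I := by
    push_cast; ring
  rw [tfShiftFun, norm_mul, h, Complex.norm_exp_ofReal_mul_I, one_mul]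

theorem continuous_tfShiftFun {u : ℝ → ℂ} (hu : Continuous u) :
    Continuous fun q : (ℝ × ℝ) × ℝ => tfShiftFun q.1 u q.2 := by
  unfold tfShiftFun; fun_prop

theorem exists_norm_le_schwartz (φ : 𝓢(ℝ, ℂ)) : ∃ B : ℝ, 0 ≤ B ∧ ∀ t, ‖φ t‖ ≤ B := by
  obtain ⟨B, hB, h⟩ := φ.decay 0 0
  exact ⟨B, hB.le, fun t => by simpa using h t⟩

theorem stft_toLp_eq_integral (φ : 𝓢(ℝ, ℂ)) (g : L2R) (z : ℝ × ℝ) :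
    stft (φ.toLp 2) g z = ∫ t, conj (tfShiftFun z φ t) * g t :=
  inner_tfShift_eq_integral z (φ.coeFn_toLp 2) (ae_eq_refl g)

section Membership

variable {φ : 𝓢(ℝ, ℂ)} {g : L2R}

theorem integrable_stft_mul_weight (hg : g ∈ modulationSpace φ 1 1) :
    Integrable (fun z : ℝ × ℝ => ‖stft (φ.toLp 2) g z‖ * (1 + |z.1| + |z.2|)) := by
  have h := (memLp_one_iff_integrable.1 hg).norm
  refine h.congr (ae_of_all _ fun z => ?_)
  simp only [vWeight, Real.rpow_one, norm_mul, Complex.norm_real]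
  rw [Real.norm_of_nonneg (by positivity)]

theorem integrable_stft (hg : g ∈ modulationSpace φ 1 1) :
    Integrable (stft (φ.toLp 2) g) := by
  have h := memLp_one_iff_integrable.1 hg
  have hc : Continuous fun z : ℝ × ℝ => (((1 + |z.1| + |z.2|)⁻¹ : ℝ) : ℂ) := by
    refine Complex.continuous_ofReal.comp (Continuous.inv₀ (by fun_prop) fun z => ?_)
    positivity
  refine (h.bdd_mul (c := 1) hc.aestronglyMeasurable (ae_of_all _ fun z => ?_)).congr
    (ae_of_all _ fun z => ?_)
  · rw [Complex.norm_real, Real.norm_of_nonneg (by positivity)]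
    refine inv_le_one_of_one_le₀ ?_
    linarith [abs_nonneg z.1, abs_nonneg z.2]
  · have : ((1 + |z.1| + |z.2| : ℝ) : ℂ) ≠ 0 := by
      rw [Complex.ofReal_ne_zero]; positivity
    simp only [vWeight, Real.rpow_one]
    rw [Complex.ofReal_inv]
    field_simp

end Membership

/-- The weak form of the inversion formula for the short-time Fourier transform. -/
theorem integral_stft_mul_integral_tfShiftFun {φ : 𝓢(ℝ, ℂ)} {g : L2R}
    (hV : Integrable (stft (φ.toLp 2) g)) {h : ℝ → ℝ} (hh : ContDiff ℝ ((⊤ : ℕ∞) : WithTop ℕ∞) h)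
    (hsupp : HasCompactSupport h) :
    ∫ z, stft (φ.toLp 2) g z * ∫ t, (h t : ℂ) * tfShiftFun z φ t
      = (∫ t, ((‖φ t‖ ^ 2 : ℝ) : ℂ)) * ∫ t, (h t : ℂ) * g t := by
  obtain ⟨B, hB0, hB⟩ := exists_norm_le_schwartz φ
  have hhi : Integrable (fun t => (h t : ℂ)) :=
    (hh.continuous.integrable_of_hasCompactSupport hsupp).ofReal
  have hint : Integrable
      (fun z => stft (φ.toLp 2) g z * ∫ t, (h t : ℂ) * tfShiftFun z φ t) := by
    refine (hV.mul_const ((∫ t, ‖(h t : ℂ)‖ * B : ℝ) : ℂ)).mono ?_ (ae_of_all _ fun z => ?_)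
    · refine hV.1.mul ?_
      have : AEStronglyMeasurable (fun q : (ℝ × ℝ) × ℝ => (h q.2 : ℂ) * tfShiftFun q.1 φ q.2)
          (volume.prod volume) :=
        ((Complex.continuous_ofReal.comp (hh.continuous.comp continuous_snd)).mul
          (continuous_tfShiftFun φ.continuous)).aestronglyMeasurable
      exact this.integral_prod_right'
    · rw [norm_mul, norm_mul]
      refine mul_le_mul_of_nonneg_left ?_ (norm_nonneg _)
      rw [Complex.norm_real, Real.norm_of_nonneg (integral_nonneg fun t => by positivity)]
      refine norm_integral_le_of_norm_le (hhi.norm.mul_const B) (ae_of_all _ fun t => ?_)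
      rw [norm_mul, norm_tfShiftFun]
      exact mul_le_mul_of_nonneg_left (hB _) (norm_nonneg _)
  -- For fixed `x` both factors are Fourier transforms in `ω` up to opposite phases, and moving the
  -- transform across the integral leaves the density `|φ(t - x)|²`. It is written with `-(x - t)`
  -- so that the remaining integral over `x` is that of a convolution.
  have hinner : ∀ x : ℝ, ∫ ω, stft (φ.toLp 2) g (x, ω) * ∫ t, (h t : ℂ) * tfShiftFun (x, ω) φ t
      = ∫ t, ((h t : ℂ) * g t) * ((‖φ (-(x - t))‖ ^ 2 : ℝ) : ℂ) := by
    intro x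
    have hshift : MemLp (fun t => φ (t - x)) 2 volume :=
      (φ.memLp 2).comp_measurePreserving (measurePreserving_sub_right volume x)
    set u : ℝ → ℂ := fun t => conj (φ (t - x)) * g t with hu
    have hui : Integrable u := hshift.star.integrable_mul (Lp.memLp g)
    have hψc : HasCompactSupport fun t => (h t : ℂ) * φ (t - x) :=
      (hsupp.comp_left Complex.ofReal_zero).mul_right
    have hψs : ContDiff ℝ ((⊤ : ℕ∞) : WithTop ℕ∞) fun t => (h t : ℂ) * φ (t - x) :=
      (Complex.ofRealCLM.contDiff.comp hh).mul ((φ.smooth ⊤).comp (contDiff_id.sub contDiff_const))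
    set ψ : 𝓢(ℝ, ℂ) := hψc.toSchwartzMap hψs with hψ
    have hψt : ∀ t, ψ t = (h t : ℂ) * φ (t - x) := fun t => rfl
    have h1 : ∀ ω : ℝ, stft (φ.toLp 2) g (x, ω) * (∫ t, (h t : ℂ) * tfShiftFun (x, ω) φ t)
        = 𝓕 u ω • (𝓕⁻ ψ) ω := by
      intro ω
      have e1 : stft (φ.toLp 2) g (x, ω)
          = Complex.exp (2 * Real.pi * Complex.I * ω * x) * 𝓕 u ω := by
        rw [stft_toLp_eq_integral, Real.fourier_eq', ← integral_const_mul]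
        refine integral_congr_ae (ae_of_all _ fun t => ?_)
        simp only [tfShiftFun, map_mul, ← Complex.exp_conj, hu, smul_eq_mul, ← mul_assoc,
          ← Complex.exp_add]
        congr 3
        simp [map_ofNat]
        ring
      have e2 : ∫ t, (h t : ℂ) * tfShiftFun (x, ω) φ t
          = Complex.exp (-(2 * Real.pi * Complex.I * ω * x)) * (𝓕⁻ ψ) ω := by
        rw [SchwartzMap.fourierInv_coe, Real.fourierInv_eq', ← integral_const_mul]
        refine integral_congr_ae (ae_of_all _ fun t => ?_)
        simp only [tfShiftFun, hψt, smul_eq_mul]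
        rw [mul_left_comm, ← mul_assoc (Complex.exp _) (Complex.exp _), ← Complex.exp_add]
        congr 2
        simp
        ring
      rw [e1, e2, Complex.exp_neg, smul_eq_mul]
      field_simp [Complex.exp_ne_zero]
    simp only [h1]
    have h2 : ∫ ω, 𝓕 u ω • (𝓕⁻ ψ) ω = ∫ t, u t • 𝓕 (𝓕⁻ ψ : 𝓢(ℝ, ℂ)) t := by
      simpa only [flip_innerₗ] using! VectorFourier.integral_fourierIntegral_smul_eq_flip (L := innerₗ ℝ)
        Real.continuous_fourierChar continuous_inner hui
        ((𝓕⁻ ψ : 𝓢(ℝ, ℂ)).integrable (μ := volume))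
    rw [h2]
    refine integral_congr_ae (ae_of_all _ fun t => ?_)
    simp only [FourierTransform.fourier_fourierInv_eq, hψt, hu, smul_eq_mul, neg_sub]
    have : ((‖φ (t - x)‖ ^ 2 : ℝ) : ℂ) = conj (φ (t - x)) * φ (t - x) := by
      rw [mul_comm, Complex.mul_conj, Complex.normSq_eq_norm_sq]
    rw [this]
    ring
  rw [Measure.volume_eq_prod, integral_prod _ (by rwa [← Measure.volume_eq_prod])]
  simp only [hinner]
  have hgh : Integrable (fun t => (h t : ℂ) * g t) := by
    have : MemLp (fun t => (h t : ℂ)) 2 volume :=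
      (Complex.continuous_ofReal.comp hh.continuous).memLp_of_hasCompactSupport
        (hsupp.comp_left Complex.ofReal_zero)
    exact this.integrable_mul (Lp.memLp g)
  have hφi : Integrable (fun s => ((‖φ (-s)‖ ^ 2 : ℝ) : ℂ)) :=
    ((memLp_two_iff_integrable_sq_norm (φ.memLp 2).1).1 (φ.memLp 2)).comp_neg.ofReal
  have hconv := integral_convolution (ContinuousLinearMap.mul ℂ ℂ) hgh hφi
  simp only [convolution_def, ContinuousLinearMap.mul_apply'] at hconv
  rw [hconv, integral_neg_eq_self (fun s => ((‖φ s‖ ^ 2 : ℝ) : ℂ)), mul_comm]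

/-- The synthesis of the short-time Fourier transform. -/
def stftSynthesis (φ : 𝓢(ℝ, ℂ)) (g : L2R) (t : ℝ) : ℂ :=
  ∫ z, stft (φ.toLp 2) g z * tfShiftFun z φ t

/-- Integrability of the transform turns the weak inversion formula into a pointwise one: by Fubini,
both sides have the same integrals against smooth compactly supported functions. -/
theorem ae_eq_stftSynthesis {φ : 𝓢(ℝ, ℂ)} (hφ : φ ≠ 0) {g : L2R}
    (hV : Integrable (stft (φ.toLp 2) g)) :
    g =ᵐ[volume] fun t => (∫ t, ((‖φ t‖ ^ 2 : ℝ) : ℂ))⁻¹ * stftSynthesis φ g t := by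
  obtain ⟨B, hB0, hB⟩ := exists_norm_le_schwartz φ
  have hnorm : (∫ t, ((‖φ t‖ ^ 2 : ℝ) : ℂ)) ≠ 0 := by
    rw [integral_complex_ofReal, Complex.ofReal_ne_zero]
    intro h0
    apply hφ
    have hi := (memLp_two_iff_integrable_sq_norm (φ.memLp 2).1).1 (φ.memLp 2)
    rw [integral_eq_zero_iff_of_nonneg (fun x => by positivity) hi] at h0
    have h1 : (fun t => ‖φ t‖ ^ 2) = 0 :=
      (Continuous.ae_eq_iff_eq volume (by fun_prop) continuous_zero).1 h0
    ext t
    have := congr_fun h1 t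
    simpa using this
  have hjoint : AEStronglyMeasurable
      (fun q : ℝ × ℝ × ℝ => stft (φ.toLp 2) g q.2 * tfShiftFun q.2 φ q.1)
      (volume.prod volume) :=
    hV.1.comp_snd.mul
      ((continuous_tfShiftFun φ.continuous).comp continuous_swap).aestronglyMeasurable
  have hmeas : AEStronglyMeasurable (stftSynthesis φ g) volume := hjoint.integral_prod_right'
  have hbd : ∀ t, ‖stftSynthesis φ g t‖ ≤ ∫ z, ‖stft (φ.toLp 2) g z‖ * B := by
    intro t
    refine norm_integral_le_of_norm_le (hV.norm.mul_const B) (ae_of_all _ fun z => ?_)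
    rw [norm_mul, norm_tfShiftFun]
    exact mul_le_mul_of_nonneg_left (hB _) (norm_nonneg _)
  have hloc : LocallyIntegrable (stftSynthesis φ g) :=
    (memLp_top_of_bound hmeas _ (ae_of_all _ hbd)).locallyIntegrable le_top
  refine ae_eq_of_integral_contDiff_smul_eq
    ((Lp.memLp g).locallyIntegrable (by norm_num)) (hloc.smul (_ : ℂ)) fun h hh hsupp => ?_
  have hhi : Integrable (fun t => (h t : ℂ)) :=
    (hh.continuous.integrable_of_hasCompactSupport hsupp).ofReal
  have hinv := integral_stft_mul_integral_tfShiftFun hV hh hsupp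
  have hswap : ∫ t, (h t : ℂ) * stftSynthesis φ g t
      = ∫ z, stft (φ.toLp 2) g z * ∫ t, (h t : ℂ) * tfShiftFun z φ t := by
    simp only [stftSynthesis, ← integral_const_mul]
    rw [integral_integral_swap]
    · refine integral_congr_ae (ae_of_all _ fun z => integral_congr_ae (ae_of_all _ fun t => ?_))
      simp only
      ring
    · refine Integrable.mono' ((hhi.norm.mul_prod hV.norm).mul_const B) ?_
        (ae_of_all _ fun q => ?_)
      · exact (hhi.1.comp_fst).mul hjoint
      · simp only [Function.uncurry, norm_mul, norm_tfShiftFun, ← mul_assoc]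
        exact mul_le_mul_of_nonneg_left (hB _) (by positivity)
  rw [← hswap] at hinv
  simp only [Complex.real_smul]
  calc ∫ t, (h t : ℂ) * g t
      = (∫ t, ((‖φ t‖ ^ 2 : ℝ) : ℂ))⁻¹ * ∫ t, (h t : ℂ) * stftSynthesis φ g t := by
        rw [hinv, ← mul_assoc, inv_mul_cancel₀ hnorm, one_mul]
    _ = _ := by
        rw [← integral_const_mul]
        congr! 2
        ring

/-! ### Decay and regularity of the synthesis integral along the lattice. -/

theorem summable_inv_one_add_abs_sq : Summable fun n : ℤ => 1 / (1 + |(n : ℝ)|) ^ 2 := by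
  have h : Summable fun n : ℕ => 1 / (1 + (n : ℝ)) ^ 2 := by
    have := (summable_nat_add_iff 1).2 (Real.summable_one_div_nat_pow.2 one_lt_two)
    refine this.congr fun n => ?_
    push_cast
    rw [add_comm]
  rw [summable_int_iff_summable_nat_and_neg]
  constructor <;> simpa using h

theorem exists_sum_inv_one_add_abs_sub_sq_le :
    ∃ B : ℝ, 0 ≤ B ∧ ∀ (θ : ℝ) (F : Finset ℤ), ∑ n ∈ F, 1 / (1 + |n - θ|) ^ 2 ≤ B := by
  -- Replacing `θ` by its floor at most doubles `1 + |n - θ|`, which costs a factor `4` after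
  -- squaring.
  refine ⟨4 * ∑' n : ℤ, 1 / (1 + |(n : ℝ)|) ^ 2, ?_, fun θ F => ?_⟩
  · exact mul_nonneg (by norm_num) (tsum_nonneg fun n => by positivity)
  · have hs := (Equiv.subRight ⌊θ⌋).summable_iff.2 summable_inv_one_add_abs_sq
    have he := (Equiv.subRight ⌊θ⌋).tsum_eq fun n : ℤ => 1 / (1 + |(n : ℝ)|) ^ 2
    rw [← he, ← tsum_mul_left]
    refine le_trans (Finset.sum_le_sum fun n _ => ?_)
      ((hs.mul_left 4).sum_le_tsum F fun n _ => by positivity)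
    simp only [Equiv.subRight_apply, Int.cast_sub]
    have h1 : |(n : ℝ) - ⌊θ⌋| ≤ |n - θ| + 1 := by
      calc |(n : ℝ) - ⌊θ⌋| = |(n - θ) + (θ - ⌊θ⌋)| := by ring_nf
        _ ≤ |n - θ| + |θ - ⌊θ⌋| := abs_add_le _ _
        _ ≤ _ := by
          rw [abs_of_nonneg (by linarith [Int.floor_le θ] : (0 : ℝ) ≤ θ - ⌊θ⌋)]
          linarith [Int.lt_floor_add_one θ]
    rw [mul_one_div, div_le_div_iff₀ (by positivity) (by positivity)]
    nlinarith [abs_nonneg ((n : ℝ) - ⌊θ⌋), abs_nonneg (n - θ)]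

/-- Rapid decay of a dilated Schwartz function, uniformly over translations by `[0, 1]`. -/
theorem exists_one_add_abs_pow_mul_norm_schwartz_le {a : ℝ} (ha : 0 < a) (φ : 𝓢(ℝ, ℂ)) :
    ∃ D : ℝ, 0 ≤ D ∧ ∀ x ∈ Icc (0 : ℝ) 1, ∀ s : ℝ,
      ‖φ (a * (x + s))‖ ≤ D / (1 + |s|) ^ 3 := by
  have hdec := φ.one_add_le_sup_seminorm_apply (𝕜 := ℝ) (m := (3, 0)) (k := 3) (n := 0)
    le_rfl le_rfl
  set C := 2 ^ (3, 0).1 * ((Finset.Iic ((3, 0) : ℕ × ℕ)).sup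
    fun m => SchwartzMap.seminorm ℝ (E := ℝ) (F := ℂ) m.1 m.2) φ
  have hC : 0 ≤ C := le_trans (by positivity) (hdec 0)
  refine ⟨(2 + 1 / a) ^ 3 * C, by positivity, fun x hx s => ?_⟩
  have h1 := hdec (a * (x + s))
  rw [norm_iteratedFDeriv_zero] at h1
  have h2 : 1 + |s| ≤ (2 + 1 / a) * (1 + ‖a * (x + s)‖) := by
    rw [norm_mul, Real.norm_of_nonneg ha.le, Real.norm_eq_abs]
    have h3 : |s| ≤ |x + s| + 1 := by
      calc |s| = |(x + s) - x| := by ring_nf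
        _ ≤ |x + s| + |x| := abs_sub _ _
        _ ≤ _ := by rw [abs_of_nonneg hx.1]; linarith [hx.2]
    have h4 : (1 / a) * (a * |x + s|) = |x + s| := by field_simp
    have h5 : 0 < 1 / a := by positivity
    have h6 : 0 ≤ a * |x + s| := by positivity
    nlinarith
  rw [le_div_iff₀ (by positivity), mul_comm]
  calc (1 + |s|) ^ 3 * ‖φ (a * (x + s))‖
      ≤ ((2 + 1 / a) * (1 + ‖a * (x + s)‖)) ^ 3 * ‖φ (a * (x + s))‖ := by gcongr
    _ = (2 + 1 / a) ^ 3 * ((1 + ‖a * (x + s)‖) ^ 3 * ‖φ (a * (x + s))‖) := by ring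
    _ ≤ _ := by gcongr

/-- One weight linear in `z` controls size, size times `|n|`, and Lipschitz constant. The Schwartz
decay is used to order three: one power may be spent on `|n|`, and the remaining two are summable in
`n`. -/
theorem exists_tfShiftFun_schwartz_bounds {a : ℝ} (ha : 0 < a) (φ : 𝓢(ℝ, ℂ)) :
    ∃ E : ℝ, 0 ≤ E ∧ ∀ (z : ℝ × ℝ) (n : ℤ),
      let w := E * (1 + |z.1| + |z.2|) * (1 / (1 + |n - z.1 / a|) ^ 2)
      (∀ x ∈ Icc (0 : ℝ) 1, ‖tfShiftFun z φ (a * (x + n))‖ ≤ w) ∧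
      (∀ x ∈ Icc (0 : ℝ) 1, |(n : ℝ)| * ‖tfShiftFun z φ (a * (x + n))‖ ≤ w) ∧
      ∀ x ∈ Icc (0 : ℝ) 1, ∀ y ∈ Icc (0 : ℝ) 1,
        ‖tfShiftFun z φ (a * (x + n)) - tfShiftFun z φ (a * (y + n))‖ ≤ w * |x - y| := by
  obtain ⟨D₀, hD₀, h₀⟩ := exists_one_add_abs_pow_mul_norm_schwartz_le ha φ
  obtain ⟨D₁, hD₁, h₁⟩ := exists_one_add_abs_pow_mul_norm_schwartz_le ha
    (SchwartzMap.derivCLM ℂ ℂ φ)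
  -- The parts `1 + 1 / a` and `a * (2 * Real.pi + 1)` come from the factor `|n|` and from the
  -- derivative.
  set c : ℝ := 1 + 1 / a + a * (2 * Real.pi + 1) with hc
  have hcpos : 0 < c := by positivity
  refine ⟨(D₀ + D₁) * c, by positivity, fun z n => ?_⟩
  intro w
  set v : ℝ := 1 + |z.1| + |z.2| with hv
  set s : ℝ := n - z.1 / a with hs
  have hv1 : 1 ≤ v := by rw [hv]; linarith [abs_nonneg z.1, abs_nonneg z.2]
  have hpt : ∀ x : ℝ, a * (x + n) - z.1 = a * (x + s) := by
    intro x; rw [hs]; field_simp; ring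
  have hs2 : 1 / (1 + |s|) ^ 3 ≤ 1 / (1 + |s|) ^ 2 :=
    one_div_le_one_div_of_le (by positivity)
      (pow_le_pow_right₀ (by linarith [abs_nonneg s]) (by norm_num))
  have hw : ∀ d : ℝ, 0 ≤ d → d ≤ c * v →
      (D₀ + D₁) * (d * (1 / (1 + |s|) ^ 2)) ≤ w := by
    intro d hd0 hd
    calc (D₀ + D₁) * (d * (1 / (1 + |s|) ^ 2))
        ≤ (D₀ + D₁) * ((c * v) * (1 / (1 + |s|) ^ 2)) := by gcongr
      _ = w := by simp only [w]; ring
  have hφ : ∀ x ∈ Icc (0 : ℝ) 1, ‖φ (a * (x + s))‖ ≤ (D₀ + D₁) * (1 / (1 + |s|) ^ 3) := by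
    intro x hx
    refine (h₀ x hx s).trans ?_
    rw [mul_one_div]
    gcongr
    linarith
  have hφ' : ∀ x ∈ Icc (0 : ℝ) 1,
      ‖deriv φ (a * (x + s))‖ ≤ (D₀ + D₁) * (1 / (1 + |s|) ^ 3) := by
    intro x hx
    refine (h₁ x hx s).trans ?_
    rw [mul_one_div]
    gcongr
    linarith
  have h1a : 0 < 1 / a := by positivity
  have h2a : 0 < a * (2 * Real.pi + 1) := by positivity
  have hc1 : 1 ≤ c := by rw [hc]; linarith
  refine ⟨fun x hx => ?_, fun x hx => ?_, fun x hx y hy => ?_⟩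
  · rw [norm_tfShiftFun, hpt]
    refine (hφ x hx).trans (le_trans ?_ (hw 1 zero_le_one (by nlinarith)))
    rw [one_mul]
    gcongr
  · rw [norm_tfShiftFun, hpt]
    -- Large `n` is either far from `z.1 / a`, which costs one power of decay, or forces `z.1` to be
    -- large, which the weight absorbs.
    have hn : |(n : ℝ)| ≤ (1 + |z.1| / a) * (1 + |s|) := by
      have : (n : ℝ) = s + z.1 / a := by rw [hs]; ring
      rw [this]
      refine (abs_add_le _ _).trans ?_
      rw [abs_div, abs_of_pos ha]
      have : 0 ≤ |z.1| / a := by positivity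
      nlinarith [abs_nonneg s]
    calc |(n : ℝ)| * ‖φ (a * (x + s))‖
        ≤ ((1 + |z.1| / a) * (1 + |s|)) * ((D₀ + D₁) * (1 / (1 + |s|) ^ 3)) := by
          gcongr; exact hφ x hx
      _ = (D₀ + D₁) * ((1 + |z.1| / a) * (1 / (1 + |s|) ^ 2)) := by field_simp
      _ ≤ w := by
          refine hw _ (by positivity) ?_
          have h1 : |z.1| ≤ v := by rw [hv]; linarith [abs_nonneg z.2]
          have h2 : |z.1| / a ≤ 1 / a * v := by
            rw [div_eq_mul_one_div, mul_comm]; gcongr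
          calc 1 + |z.1| / a ≤ v + 1 / a * v := by gcongr
            _ = (1 + 1 / a) * v := by ring
            _ ≤ c * v := by gcongr; rw [hc]; linarith
  · let ρ' : ℝ → ℂ := fun x => Complex.exp (2 * Real.pi * Complex.I * z.2 * ((a * (x + s) : ℝ) : ℂ))
        * (2 * Real.pi * Complex.I * z.2 * a) * φ (a * (x + s))
      + Complex.exp (2 * Real.pi * Complex.I * z.2 * ((a * (x + s) : ℝ) : ℂ))
        * (a * deriv φ (a * (x + s)))
    have hfun : ∀ x : ℝ, tfShiftFun z φ (a * (x + n))
        = Complex.exp (2 * Real.pi * Complex.I * z.2 * ((a * (x + s) : ℝ) : ℂ))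
          * φ (a * (x + s)) := by
      intro x
      rw [tfShiftFun, hpt, ← hpt]
      push_cast
      rfl
    have hder : ∀ x : ℝ, HasDerivAt (fun x : ℝ => tfShiftFun z φ (a * (x + n))) (ρ' x) x := by
      intro x
      simp only [hfun]
      have hlin : HasDerivAt (fun x : ℝ => a * (x + s)) a x := by
        simpa using ((hasDerivAt_id x).add_const s).const_mul a
      have hexp := ((hlin.ofReal_comp).const_mul (2 * Real.pi * Complex.I * z.2)).cexp
      have hφd : HasDerivAt (fun x : ℝ => φ (a * (x + s))) (a * deriv φ (a * (x + s))) x := by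
        have := (φ.differentiableAt (x := a * (x + s))).hasDerivAt.scomp x hlin
        rwa [Complex.real_smul] at this
      exact hexp.mul hφd
    have hexpn : ∀ r : ℝ, ‖Complex.exp (2 * Real.pi * Complex.I * z.2 * (r : ℂ))‖ = 1 := by
      intro r
      have : (2 * Real.pi * Complex.I * z.2 * (r : ℂ) : ℂ)
          = ((2 * Real.pi * z.2 * r : ℝ) : ℂ) * Complex.I := by push_cast; ring
      rw [this, Complex.norm_exp_ofReal_mul_I]
    have hbound : ∀ x ∈ Icc (0 : ℝ) 1, ‖ρ' x‖ ≤ w := by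
      intro x hx
      have hnc : ‖(2 * Real.pi * Complex.I * z.2 * a : ℂ)‖ = 2 * Real.pi * |z.2| * a := by
        simp [abs_of_pos ha, abs_of_pos Real.pi_pos]
      calc ‖ρ' x‖ ≤ (2 * Real.pi * |z.2| * a) * ‖φ (a * (x + s))‖
            + a * ‖deriv φ (a * (x + s))‖ := by
            refine (norm_add_le _ _).trans_eq ?_
            rw [norm_mul (Complex.exp _ * _), norm_mul (Complex.exp _), norm_mul (Complex.exp _),
              hexpn, hnc, norm_mul (a : ℂ), Complex.norm_real, Real.norm_of_nonneg ha.le, one_mul,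
              one_mul]
        _ ≤ (2 * Real.pi * |z.2| * a) * ((D₀ + D₁) * (1 / (1 + |s|) ^ 2))
            + a * ((D₀ + D₁) * (1 / (1 + |s|) ^ 2)) := by
            gcongr
            · exact (hφ x hx).trans (by gcongr)
            · exact (hφ' x hx).trans (by gcongr)
        _ = (D₀ + D₁) * ((2 * Real.pi * |z.2| * a + a) * (1 / (1 + |s|) ^ 2)) := by ring
        _ ≤ w := by
            refine hw _ (by positivity) ?_
            have h1 : |z.2| ≤ v := by rw [hv]; linarith [abs_nonneg z.1]
            calc 2 * Real.pi * |z.2| * a + a ≤ 2 * Real.pi * v * a + a * v :=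
                  add_le_add (by gcongr) (le_mul_of_one_le_right ha.le hv1)
              _ = a * (2 * Real.pi + 1) * v := by ring
              _ ≤ c * v := by gcongr; rw [hc]; linarith
    exact (convex_Icc (0 : ℝ) 1).norm_image_sub_le_of_norm_hasDerivWithin_le
      (fun x _ => (hder x).hasDerivWithinAt) hbound hy hx

/-- Local regularity and decay of the synthesis of a short-time Fourier transform with a
weighted integrability condition. -/
theorem exists_summable_bound_stftSynthesis {a : ℝ} (ha : 0 < a) {φ : 𝓢(ℝ, ℂ)} {g : L2R}
    (hg : g ∈ modulationSpace φ 1 1) :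
    ∃ W : ℤ → ℝ, Summable W ∧ ∀ n : ℤ,
      (∀ x ∈ Icc (0 : ℝ) 1, ‖stftSynthesis φ g (a * (x + n))‖ ≤ W n) ∧
      (∀ x ∈ Icc (0 : ℝ) 1, |(n : ℝ)| * ‖stftSynthesis φ g (a * (x + n))‖ ≤ W n) ∧
      ∀ x ∈ Icc (0 : ℝ) 1, ∀ y ∈ Icc (0 : ℝ) 1,
        ‖stftSynthesis φ g (a * (x + n)) - stftSynthesis φ g (a * (y + n))‖ ≤ W n * |x - y| := by
  obtain ⟨E, hE, hb⟩ := exists_tfShiftFun_schwartz_bounds ha φ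
  obtain ⟨B, hB0, hB⟩ := exists_sum_inv_one_add_abs_sub_sq_le
  obtain ⟨Bφ, hBφ0, hBφ⟩ := exists_norm_le_schwartz φ
  have hV := integrable_stft hg
  have hVw := integrable_stft_mul_weight hg
  set V := stft (φ.toLp 2) g with hVdef
  let w : ℤ → ℝ × ℝ → ℝ := fun n z =>
    E * (1 + |z.1| + |z.2|) * (1 / (1 + |n - z.1 / a|) ^ 2)
  have hwc : ∀ n, Continuous fun z : ℝ × ℝ => 1 / (1 + |n - z.1 / a|) ^ 2 := fun n =>
    continuous_const.div (by fun_prop) fun z => by positivity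
  have hwi : ∀ n : ℤ, Integrable fun z => ‖V z‖ * w n z := by
    intro n
    refine ((hVw.const_mul E).bdd_mul (c := 1) (hwc n).aestronglyMeasurable
      (ae_of_all _ fun z => ?_)).congr (ae_of_all _ fun z => ?_)
    · rw [Real.norm_of_nonneg (by positivity), one_div]
      refine inv_le_one_of_one_le₀ (one_le_pow₀ ?_)
      linarith [abs_nonneg (n - z.1 / a)]
    · simp only [w]; ring
  have hρi : ∀ t : ℝ, Integrable fun z => V z * tfShiftFun z φ t := by
    intro t
    refine hV.mul_bdd (c := Bφ) ?_ (ae_of_all _ fun z => ?_)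
    · exact ((continuous_tfShiftFun φ.continuous).comp
        (by fun_prop : Continuous fun z : ℝ × ℝ => (z, t))).aestronglyMeasurable
    · rw [norm_tfShiftFun]; exact hBφ _
  refine ⟨fun n => ∫ z, ‖V z‖ * w n z, ?_, fun n => ⟨fun x hx => ?_, fun x hx => ?_,
    fun x hx y hy => ?_⟩⟩
  -- The sum over `n` is taken under the integral, where it is bounded uniformly in `z`; what
  -- remains is the `M¹₁` integral.
  · refine summable_of_sum_le (c := ∫ z, E * B * (‖V z‖ * (1 + |z.1| + |z.2|)))
      (fun n => integral_nonneg fun z => by positivity) fun F => ?_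
    rw [← integral_finsetSum _ fun n _ => hwi n]
    refine integral_mono (integrable_finsetSum _ fun n _ => hwi n) (hVw.const_mul _) fun z => ?_
    calc ∑ n ∈ F, ‖V z‖ * w n z
        = (E * (‖V z‖ * (1 + |z.1| + |z.2|))) * ∑ n ∈ F, 1 / (1 + |n - z.1 / a|) ^ 2 := by
          rw [Finset.mul_sum]; refine Finset.sum_congr rfl fun n _ => ?_; simp only [w]; ring
      _ ≤ (E * (‖V z‖ * (1 + |z.1| + |z.2|))) * B := by gcongr; exact hB _ _
      _ = _ := by ring
  · refine norm_integral_le_of_norm_le (hwi n) (ae_of_all _ fun z => ?_)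
    rw [norm_mul]
    exact mul_le_mul_of_nonneg_left ((hb z n).1 x hx) (norm_nonneg _)
  · rw [← abs_norm (stftSynthesis φ g _), ← abs_mul, ← Real.norm_eq_abs, norm_mul, norm_norm,
      ← Complex.norm_real, ← norm_mul, stftSynthesis, ← integral_const_mul]
    refine norm_integral_le_of_norm_le (hwi n) (ae_of_all _ fun z => ?_)
    rw [norm_mul, norm_mul, mul_left_comm, Complex.norm_real, Real.norm_eq_abs]
    exact mul_le_mul_of_nonneg_left ((hb z n).2.1 x hx) (norm_nonneg _)
  · rw [stftSynthesis, stftSynthesis, ← integral_sub (hρi _) (hρi _), ← integral_mul_const]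
    refine norm_integral_le_of_norm_le ((hwi n).mul_const _) (ae_of_all _ fun z => ?_)
    rw [← mul_sub, norm_mul, mul_assoc]
    exact mul_le_mul_of_nonneg_left ((hb z n).2.2 x hx y hy) (norm_nonneg _)

/-! ### The Zak series: Lipschitz bound, quasi-periodicity, Fourier coefficients. -/

theorem norm_unitExp_sub_le (n : ℤ) (x y : ℝ) :
    ‖unitExp n x - unitExp n y‖ ≤ 2 * Real.pi * |(n : ℝ)| * |x - y| := by
  have h : unitExp n x - unitExp n y
      = unitExp n y * (Complex.exp (Complex.I * ((2 * Real.pi * n * (x - y) : ℝ) : ℂ)) - 1) := by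
    rw [mul_sub, mul_one, unitExp, unitExp, ← Complex.exp_add]
    congr 2
    push_cast
    ring
  rw [h, norm_mul, norm_unitExp, one_mul]
  refine Real.norm_exp_I_mul_ofReal_sub_one_le.trans_eq ?_
  rw [Real.norm_eq_abs, abs_mul, abs_mul, abs_of_pos Real.two_pi_pos]

/-- The Fourier series in `ξ` with coefficients `f n x`. -/
def zakSeries (f : ℤ → ℝ → ℂ) (p : ℝ × ℝ) : ℂ := ∑' n, unitExp n p.1 * f n p.2

section ZakSeries

variable {f : ℤ → ℝ → ℂ} {W : ℤ → ℝ}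

theorem summable_zakSeries (hW : Summable W) (h1 : ∀ n, ∀ x ∈ Icc (0 : ℝ) 1, ‖f n x‖ ≤ W n)
    {p : ℝ × ℝ} (hp : p.2 ∈ Icc (0 : ℝ) 1) : Summable fun n => unitExp n p.1 * f n p.2 :=
  hW.of_norm_bounded fun n => by rw [norm_mul, norm_unitExp, one_mul]; exact h1 n _ hp

/-- A change in `ξ` costs a factor `2π|n|` on the `n`-th term, covered by `h2`; a change in `x` is
covered by `h3`. -/
theorem norm_zakSeries_sub_le (hW : Summable W)
    (h1 : ∀ n, ∀ x ∈ Icc (0 : ℝ) 1, ‖f n x‖ ≤ W n)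
    (h2 : ∀ n : ℤ, ∀ x ∈ Icc (0 : ℝ) 1, |(n : ℝ)| * ‖f n x‖ ≤ W n)
    (h3 : ∀ n, ∀ x ∈ Icc (0 : ℝ) 1, ∀ y ∈ Icc (0 : ℝ) 1, ‖f n x - f n y‖ ≤ W n * |x - y|)
    {p q : ℝ × ℝ} (hp : p.2 ∈ Icc (0 : ℝ) 1) (hq : q.2 ∈ Icc (0 : ℝ) 1) :
    ‖zakSeries f p - zakSeries f q‖ ≤ ((2 * Real.pi + 1) * ∑' n, W n) * dist p q := by
  rw [zakSeries, zakSeries,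
    ← (summable_zakSeries hW h1 hp).tsum_sub (summable_zakSeries hW h1 hq)]
  have hd1 : |p.1 - q.1| ≤ dist p q := le_max_left (dist p.1 q.1) (dist p.2 q.2)
  have hd2 : |p.2 - q.2| ≤ dist p q := le_max_right (dist p.1 q.1) (dist p.2 q.2)
  refine tsum_of_norm_bounded (((hW.hasSum).mul_left _).mul_right _) fun n => ?_
  have hWn : 0 ≤ W n := (norm_nonneg _).trans (h1 n _ hp)
  calc ‖unitExp n p.1 * f n p.2 - unitExp n q.1 * f n q.2‖
      = ‖(unitExp n p.1 - unitExp n q.1) * f n p.2 + unitExp n q.1 * (f n p.2 - f n q.2)‖ := by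
        congr 1; ring
    _ ≤ (2 * Real.pi * |(n : ℝ)| * |p.1 - q.1|) * ‖f n p.2‖ + 1 * (W n * |p.2 - q.2|) := by
        refine (norm_add_le _ _).trans ?_
        rw [norm_mul, norm_mul, norm_unitExp]
        gcongr
        · exact norm_unitExp_sub_le _ _ _
        · exact h3 n _ hp _ hq
    _ = 2 * Real.pi * |p.1 - q.1| * (|(n : ℝ)| * ‖f n p.2‖) + W n * |p.2 - q.2| := by ring
    _ ≤ 2 * Real.pi * dist p q * W n + W n * dist p q := by
        gcongr
        exact h2 n _ hp
    _ = (2 * Real.pi + 1) * W n * dist p q := by ring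

theorem zakSeries_one_right (hf : ∀ n, f n 1 = f (n + 1) 0) (ξ : ℝ) :
    zakSeries f (ξ, 1) = unitExp (-1) ξ * zakSeries f (ξ, 0) := by
  simp only [zakSeries]
  rw [← (Equiv.addRight (1 : ℤ)).tsum_eq fun n => unitExp n ξ * f n 0, ← tsum_mul_left]
  refine tsum_congr fun n => ?_
  simp only [Equiv.coe_addRight]
  rw [hf, ← mul_assoc, ← unitExp_add]
  congr 2
  ring

theorem zakSeries_one_left (x : ℝ) : zakSeries f (1, x) = zakSeries f (0, x) := by
  have h : ∀ n, unitExp n 1 = unitExp n 0 := fun n => by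
    rw [unitExp_one_right]; simp [unitExp]
  simp only [zakSeries, h]

/-- Integrating term by term, orthogonality in `ξ` leaves only the term `n = k.1`. This is what
identifies the series with the abstractly defined `zak`. -/
theorem integral_squareExp_mul_zakSeries (hW : Summable W)
    (h1 : ∀ n, ∀ x ∈ Icc (0 : ℝ) 1, ‖f n x‖ ≤ W n)
    (hf : ∀ n, AEStronglyMeasurable (f n) unitMeasure) (k : ℤ × ℤ) :
    ∫ p, squareExp (-k) p * zakSeries f p ∂squareMeasure
      = ∫ x, unitExp (-k.2) x * f k.1 x ∂unitMeasure := by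
  have hfi : ∀ n, Integrable (f n) unitMeasure := fun n =>
    Integrable.of_bound (hf n) (W n) ((ae_restrict_iff' measurableSet_Ioc).2
      (ae_of_all _ fun x hx => h1 n x (Ioc_subset_Icc_self hx)))
  have hterm : ∀ n (p : ℝ × ℝ), squareExp (-k) p * (unitExp n p.1 * f n p.2)
      = unitExp (-k.1 + n) p.1 * (unitExp (-k.2) p.2 * f n p.2) := by
    intro n p
    simp only [squareExp, Prod.fst_neg, Prod.snd_neg, unitExp_add]
    ring
  have hgi : ∀ n, Integrable (fun x => unitExp (-k.2) x * f n x) unitMeasure := fun n =>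
    (hfi n).bdd_mul (c := 1) (continuous_unitExp _).aestronglyMeasurable
      (ae_of_all _ fun x => by simp)
  have hui : ∀ m, Integrable (unitExp m) unitMeasure := fun m =>
    Integrable.of_bound (continuous_unitExp m).aestronglyMeasurable 1 (ae_of_all _ fun x => by simp)
  have hint : ∀ n, Integrable (fun p => squareExp (-k) p * (unitExp n p.1 * f n p.2))
      squareMeasure := fun n => by
    simp only [hterm]
    exact (hui _).mul_prod (hgi n)
  have hnorm : ∀ n, ∫ p, ‖squareExp (-k) p * (unitExp n p.1 * f n p.2)‖ ∂squareMeasure ≤ W n := by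
    intro n
    refine (integral_mono_ae (hint n).norm (integrable_const (W n)) ?_).trans_eq (by simp)
    filter_upwards [Measure.quasiMeasurePreserving_snd.ae
      (ae_restrict_mem (μ := volume) (measurableSet_Ioc (a := (0 : ℝ)) (b := 1)))] with p hp
    simp only [norm_mul, norm_squareExp, norm_unitExp, one_mul]
    exact h1 n _ (Ioc_subset_Icc_self hp)
  have hsum := hasSum_integral_of_summable_integral_norm hint
    (hW.of_nonneg_of_le (fun n => integral_nonneg fun p => norm_nonneg _) hnorm)
  simp only [tsum_mul_left] at hsum
  have hval : ∀ n, ∫ p, squareExp (-k) p * (unitExp n p.1 * f n p.2) ∂squareMeasure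
      = if n = k.1 then ∫ x, unitExp (-k.2) x * f k.1 x ∂unitMeasure else 0 := by
    intro n
    simp only [hterm]
    rw [integral_prod_mul (unitExp (-k.1 + n)) (fun x => unitExp (-k.2) x * f n x),
      integral_unitExp]
    by_cases h : n = k.1
    · simp [h]
    · have : -k.1 + n ≠ 0 := fun h' => h (by linarith)
      simp [h, this]
  simp only [hval] at hsum
  exact hsum.unique (hasSum_ite_eq _ _)

end ZakSeries

/-! ### Conclusion for the modulation space. -/

/-- The Zak transform of a function in `M¹₁` has a Lipschitz representative with a zero. -/
theorem exists_lipschitz_zak {a : ℝ} (ha : 0 < a) {φ : 𝓢(ℝ, ℂ)} (hφ : φ ≠ 0) {g : L2R}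
    (hg : g ∈ modulationSpace φ 1 1) :
    ∃ (G : ℝ × ℝ → ℂ) (C : ℝ), zak ha g =ᵐ[squareMeasure] G ∧
      (∀ p ∈ Icc (0 : ℝ) 1 ×ˢ Icc (0 : ℝ) 1, ∀ q ∈ Icc (0 : ℝ) 1 ×ˢ Icc (0 : ℝ) 1,
        ‖G p - G q‖ ≤ C * dist p q) ∧
      ∃ p ∈ Icc (0 : ℝ) 1 ×ˢ Icc (0 : ℝ) 1, G p = 0 := by
  obtain ⟨W, hW, hb⟩ := exists_summable_bound_stftSynthesis ha hg
  set c : ℂ := (∫ t, ((‖φ t‖ ^ 2 : ℝ) : ℂ))⁻¹ with hc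
  have hgae := ae_eq_stftSynthesis hφ (integrable_stft hg)
  -- `√a` is the normalization of the Zak transform and `c` that of the inversion formula.
  set κ : ℂ := √a * c with hκ
  let f : ℤ → ℝ → ℂ := fun n x => κ * stftSynthesis φ g (a * (x + n))
  have hW' : Summable fun n => ‖κ‖ * W n := hW.mul_left _
  have h1 : ∀ n, ∀ x ∈ Icc (0 : ℝ) 1, ‖f n x‖ ≤ ‖κ‖ * W n := fun n x hx => by
    simp only [f, norm_mul]
    exact mul_le_mul_of_nonneg_left ((hb n).1 x hx) (by positivity)
  have h2 : ∀ n : ℤ, ∀ x ∈ Icc (0 : ℝ) 1, |(n : ℝ)| * ‖f n x‖ ≤ ‖κ‖ * W n := fun n x hx => by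
    simp only [f, norm_mul]
    rw [mul_left_comm]
    exact mul_le_mul_of_nonneg_left ((hb n).2.1 x hx) (norm_nonneg κ)
  have h3 : ∀ n, ∀ x ∈ Icc (0 : ℝ) 1, ∀ y ∈ Icc (0 : ℝ) 1,
      ‖f n x - f n y‖ ≤ ‖κ‖ * W n * |x - y| := fun n x hx y hy => by
    simp only [f, ← mul_sub, norm_mul κ, mul_assoc ‖κ‖]
    exact mul_le_mul_of_nonneg_left ((hb n).2.2 x hx y hy) (norm_nonneg κ)
  have hfm : ∀ n, AEStronglyMeasurable (f n) unitMeasure := fun n => by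
    have hcont : ContinuousOn (f n) (Icc 0 1) := by
      refine (LipschitzOnWith.of_dist_le_mul (K := (‖κ‖ * W n).toNNReal)
        fun x hx y hy => ?_).continuousOn
      rw [dist_eq_norm, Real.dist_eq]
      exact (h3 n x hx y hy).trans
        (mul_le_mul_of_nonneg_right (Real.le_coe_toNNReal _) (abs_nonneg _))
    exact (hcont.mono Ioc_subset_Icc_self).aestronglyMeasurable measurableSet_Ioc
  set C : ℝ := (2 * Real.pi + 1) * ∑' n, ‖κ‖ * W n with hC
  have hlip : ∀ p ∈ Icc (0 : ℝ) 1 ×ˢ Icc (0 : ℝ) 1, ∀ q ∈ Icc (0 : ℝ) 1 ×ˢ Icc (0 : ℝ) 1,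
      ‖zakSeries f p - zakSeries f q‖ ≤ C * dist p q := fun p hp q hq =>
    norm_zakSeries_sub_le hW' h1 h2 h3 hp.2 hq.2
  have hcont : ContinuousOn (zakSeries f) (Icc (0 : ℝ) 1 ×ˢ Icc (0 : ℝ) 1) := by
    refine (LipschitzOnWith.of_dist_le_mul (K := C.toNNReal) fun p hp q hq => ?_).continuousOn
    rw [dist_eq_norm]
    exact (hlip p hp q hq).trans
      (mul_le_mul_of_nonneg_right (Real.le_coe_toNNReal _) dist_nonneg)
  refine ⟨zakSeries f, C, ?_, hlip, exists_eq_zero_of_quasiperiodic hcont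
    (fun ξ _ => zakSeries_one_right (fun n => ?_) ξ) fun x _ => zakSeries_one_left x⟩
  · refine zak_ae_eq_of_integral_eq ha ?_ fun k => ?_
    · refine MemLp.of_bound ?_ (∑' n, ‖κ‖ * W n) ?_
      · rw [squareMeasure, Measure.prod_restrict]
        exact (hcont.mono (prod_mono Ioc_subset_Icc_self Ioc_subset_Icc_self)).aestronglyMeasurable
          (measurableSet_Ioc.prod measurableSet_Ioc)
      · rw [squareMeasure, Measure.prod_restrict]
        filter_upwards [ae_restrict_mem (measurableSet_Ioc.prod measurableSet_Ioc)] with p hp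
        refine tsum_of_norm_bounded hW'.hasSum fun n => ?_
        rw [norm_mul, norm_unitExp, one_mul]
        exact h1 n _ (Ioc_subset_Icc_self hp.2)
    · rw [integral_squareExp_mul_zakSeries hW' h1 hfm, inner_gaborSystem_boxLp ha k hgae,
        ← integral_const_mul]
      refine integral_congr_ae (ae_of_all _ fun x => ?_)
      simp only [f, hκ]
      ring
  · simp only [f]
    congr 3
    push_cast
    ring

theorem notMem_modulationSpace_of_le_norm_zak_mul {a : ℝ} (ha : 0 < a) {φ : 𝓢(ℝ, ℂ)} (hφ : φ ≠ 0)
    {g : L2R} {Γ : ℝ × ℝ → ℂ} (hΓ : MemLp Γ 2 squareMeasure) {c : ℝ} (hc : 0 < c)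
    (h : ∀ᵐ p ∂squareMeasure, c ≤ ‖zak ha g p‖ * ‖Γ p‖) : g ∉ modulationSpace φ 1 1 := by
  intro hg
  obtain ⟨G, C, hG, hlip, p₀, hp₀, h0⟩ := exists_lipschitz_zak ha hφ hg
  refine not_ae_le_norm_mul_norm_of_lipschitz (fun p hp => hlip p hp p₀ hp₀) hp₀ h0 hΓ hc ?_
  filter_upwards [h, hG] with p h1 h2
  rwa [← h2]

end

theorem corollary3 (a : ℝ) (ha : 0 < a) (g γ : L2R)
    (L : SummationFilter (ℤ × ℤ)) [L.NeBot] [L.LeAtTop]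
    (hpair : IsReproducingPair (gaborSystem g a (1 / a)) (gaborSystem γ a (1 / a)) L)
    (φ : 𝓢(ℝ, ℂ)) (hφ : φ ≠ 0) :
    g ∉ modulationSpace φ 1 1 ∧ γ ∉ modulationSpace φ 1 1 := by
  obtain ⟨c, hc, h⟩ := exists_le_norm_zak_mul_norm_zak ha hpair
  refine ⟨notMem_modulationSpace_of_le_norm_zak_mul ha hφ (Lp.memLp _) hc h,
    notMem_modulationSpace_of_le_norm_zak_mul ha hφ (Lp.memLp (zak ha g)) hc ?_⟩
  filter_upwards [h] with p hp
  rwa [mul_comm]
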